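/- Let $S^1=\mathbb R/\mathbb Z$ with projection $\pi:\mathbb R\to S^1$, let $\mathrm{Homeo}_+(S^1)$ be the group of orientation preserving homeomorphisms of $S^1$, let $G$ be any group, and let $\mathcal R_G$ be the set of homomorphisms $G\to\mathrm{Homeo}_+(S^1)$. A map $h:S^1\to S^1$ is *degree one monotone* if there is a nondecreasing (not necessarily continuous) map $\tilde h:\mathbb R\to\mathbb R$ with $\tilde h(x+1)=\tilde h(x)+1$ and $\pi\circ\tilde h=h\circ\pi$. Two homomorphisms $\varphi^1,\varphi^2\in\mathcal R_G$ are *semiconjugate* if either both $\varphi^1(G)$ and $\varphi^2(G)$ have a global fixed point, or neither has one and there is a degree one monotone map $h$ with $\varphi^2(g)\circ h=h\circ\varphi^1(g)$ for all $g\in G$. A homomorphism $\varphi\in\mathcal R_G$ is *of type $0$* if there is a $\varphi(G)$-invariant Borel probability measure on $S^1$; it is *minimal* if the only nonempty closed $\varphi(G)$-invariant subset of $S^1$ is $S^1$. A *minimal model* of $\varphi$ is a minimal homomorphism semiconjugate to $\varphi$. For an integer $k\ge1$, $\psi\in\mathcal R_G$ is a *$k$-fold lift* of $\chi\in\mathcal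 R_G$ if $\chi(g)\circ\pi_k=\pi_k\circ\psi(g)$ for all $g\in G$, where $\pi_k(x+\mathbb Z)=kx+\mathbb Z$. For an integer $k\ge1$, $\varphi$ is *of type $k$* if it is not of type $0$ and $k$ is the largest among the integers $m\ge1$ such that some minimal model of $\varphi$ is an $m$-fold lift of some homomorphism in $\mathcal R_G$. For $f,h\in\mathrm{Homeo}_+(S^1)$ put $$c(f,h)=\tau(\tilde f\circ\tilde h)-\tau(\tilde f)-\tau(\tilde h),$$ where $\tilde f,\tilde h$ are arbitrary lifts of $f,h$ to $\mathbb R$ and $\tau$ is the translation number; this does not depend on the lifts. For $\varphi\in\mathcal R_G$ put $\varphi^*c(g_1,g_2)=c(\varphi(g_1),\varphi(g_2))$ and $\Vert\varphi^*c\Vert=\sup_{g_1,g_2\in G}|\varphi^*c(g_1,g_2)|$. Then for every $\varphi\in\mathcal R_G$ and every integer $k\ge1$, $\varphi$ is of type $k$ if and only if $\Vert\varphi^*c\Vert=1/k$. -/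

import Mathlib

open MeasureTheory

noncomputable section

namespace CircleAction

/-- The circle `S¹ = ℝ / ℤ`; the projection `π : ℝ → S¹` is the coercion. -/
abbrev S1 : Type := UnitAddCircle

/-- `F` is a lift of `f : S¹ → S¹`: `π ∘ F = f ∘ π`.  An element `F` of Mathlib's `CircleDeg1Lift` is
a nondecreasing (not necessarily continuous) map `ℝ → ℝ` with `F (x + 1) = F x + 1`. -/
def IsLift (F : CircleDeg1Lift) (f : S1 → S1) : Prop :=
  ∀ x : ℝ, ((F x : ℝ) : S1) = f (x : S1)

/-- The group `Homeo₊(S¹)` of orientation preserving homeomorphisms of the circle: those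
homeomorphisms that lift to an increasing bijection of `ℝ` commuting with `x ↦ x + 1` (such
bijections, automatically homeomorphisms, are the units of the monoid `CircleDeg1Lift`).
The group law is composition. -/
def HomeoPlus : Subgroup (S1 ≃ₜ S1) where
  carrier := {f | ∃ F : CircleDeg1Liftˣ, IsLift (F : CircleDeg1Lift) f}
  one_mem' := ⟨1, fun _ => rfl⟩
  mul_mem' := by
    rintro f h ⟨F, hF⟩ ⟨H, hH⟩
    refine ⟨F * H, fun x => ?_⟩
    have h1 := hF ((H : CircleDeg1Lift) x)
    rw [hH x] at h1
    exact h1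
  inv_mem' := by
    rintro f ⟨F, hF⟩
    refine ⟨F⁻¹, fun x => ?_⟩
    have h1 := hF (((F⁻¹ : CircleDeg1Liftˣ) : CircleDeg1Lift) x)
    rw [CircleDeg1Lift.units_apply_inv_apply] at h1
    rw [h1]
    exact (f.symm_apply_apply _).symm

/-- A homeomorphism of the circle acting on points. -/
instance : CoeFun HomeoPlus (fun _ => S1 → S1) := ⟨fun f => (f : S1 ≃ₜ S1)⟩

/-- A map `h : S¹ → S¹` is degree one monotone if it has a nondecreasing, not necessarily continuous,
lift commuting with `x ↦ x + 1`. -/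
def IsDegreeOneMonotone (h : S1 → S1) : Prop :=
  ∃ H : CircleDeg1Lift, IsLift H h

/-- A chosen lift of `f ∈ Homeo₊(S¹)`. -/
def someLift (f : HomeoPlus) : CircleDeg1Liftˣ := f.2.choose

lemma isLift_someLift (f : HomeoPlus) : IsLift (someLift f : CircleDeg1Lift) f :=
  f.2.choose_spec

/-- The canonical bounded Euler cocycle of `Homeo₊(S¹)`,
`c(f, h) = τ(f̃ ∘ h̃) - τ(f̃) - τ(h̃)`, where `τ` is the translation number and `f̃`, `h̃` are lifts
of `f`, `h`.  By `eulerCocycle_eq` below it does not depend on the lifts. -/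
def eulerCocycle (f h : HomeoPlus) : ℝ :=
  ((someLift f * someLift h : CircleDeg1Liftˣ) : CircleDeg1Lift).translationNumber
    - (someLift f : CircleDeg1Lift).translationNumber
    - (someLift h : CircleDeg1Lift).translationNumber

lemma exists_int_of_isLift {f : HomeoPlus} {F F' : CircleDeg1Liftˣ}
    (hF : IsLift (F : CircleDeg1Lift) f) (hF' : IsLift (F' : CircleDeg1Lift) f) :
    ∃ n : ℤ, F' = CircleDeg1Lift.translate (Multiplicative.ofAdd (n : ℝ)) * F := by
  have key : ∀ x : ℝ, ∃ n : ℤ, (F' : CircleDeg1Lift) x = (F : CircleDeg1Lift) x + n := by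
    intro x
    have h1 : (((F' : CircleDeg1Lift) x - (F : CircleDeg1Lift) x : ℝ) : S1) = 0 := by
      rw [AddCircle.coe_sub, hF x, hF' x, sub_self]
    obtain ⟨n, hn⟩ := (AddCircle.coe_eq_zero_iff (1 : ℝ)).1 h1
    refine ⟨n, ?_⟩
    simp only [zsmul_eq_mul, mul_one] at hn
    linarith
  choose n hn using key
  have hper : ∀ x, n (Int.fract x) = n x := by
    intro x
    have h1 := hn (Int.fract x)
    rw [← Int.self_sub_floor, CircleDeg1Lift.map_sub_int, CircleDeg1Lift.map_sub_int, hn x] at h1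
    have h2 : (n (x - ⌊x⌋) : ℝ) = n x := by linarith
    rw [← Int.self_sub_floor]
    exact_mod_cast h2
  -- the two lifts of `x` and of `0` differ by the same integer when `0 ≤ x < 1`
  have hloc : ∀ y, 0 ≤ y → y < 1 → n ((F⁻¹ : CircleDeg1Liftˣ) y) = n ((F⁻¹ : CircleDeg1Liftˣ) 0) := by
    intro y hy0 hy1
    have e : ∀ z, (F' : CircleDeg1Lift) ((F⁻¹ : CircleDeg1Liftˣ) z) =
        z + n ((F⁻¹ : CircleDeg1Liftˣ) z) := by
      intro z
      rw [hn, CircleDeg1Lift.units_apply_inv_apply]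
    have m : Monotone fun z => (F' : CircleDeg1Lift) ((F⁻¹ : CircleDeg1Liftˣ) z) :=
      (F' : CircleDeg1Lift).monotone.comp ((F⁻¹ : CircleDeg1Liftˣ) : CircleDeg1Lift).monotone
    have m1 := m hy0
    have m2 := m hy1.le
    have e1 : (F' : CircleDeg1Lift) ((F⁻¹ : CircleDeg1Liftˣ) 1) =
        (F' : CircleDeg1Lift) ((F⁻¹ : CircleDeg1Liftˣ) 0) + 1 := by
      have := ((F' * F⁻¹ : CircleDeg1Liftˣ) : CircleDeg1Lift).map_add_one 0
      simpa using this
    simp only [e] at m1 m2 e1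
    have l1 : (n ((F⁻¹ : CircleDeg1Liftˣ) 0) : ℝ) < n ((F⁻¹ : CircleDeg1Liftˣ) y) + 1 := by
      linarith
    have l2 : (n ((F⁻¹ : CircleDeg1Liftˣ) y) : ℝ) < n ((F⁻¹ : CircleDeg1Liftˣ) 0) + 1 := by
      rcases hy0.eq_or_lt with h | h
      · rw [← h]; linarith
      · linarith
    have l1' : n ((F⁻¹ : CircleDeg1Liftˣ) 0) < n ((F⁻¹ : CircleDeg1Liftˣ) y) + 1 := by
      exact_mod_cast l1
    have l2' : n ((F⁻¹ : CircleDeg1Liftˣ) y) < n ((F⁻¹ : CircleDeg1Liftˣ) 0) + 1 := by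
      exact_mod_cast l2
    omega
  refine ⟨n ((F⁻¹ : CircleDeg1Liftˣ) 0), ?_⟩
  ext x
  simp only [Units.val_mul, CircleDeg1Lift.mul_apply, CircleDeg1Lift.translate_apply]
  have h3 := hloc (Int.fract (F x)) (Int.fract_nonneg _) (Int.fract_lt_one _)
  rw [← Int.self_sub_floor, CircleDeg1Lift.map_sub_int, CircleDeg1Lift.units_inv_apply_apply,
    ← hper, Int.fract_sub_intCast, hper] at h3
  rw [hn x, h3, add_comm]

lemma translationNumber_translate_mul (n : ℤ) (F : CircleDeg1Lift) :
    ((CircleDeg1Lift.translate (Multiplicative.ofAdd (n : ℝ)) : CircleDeg1Lift)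
      * F).translationNumber = n + F.translationNumber := by
  rw [CircleDeg1Lift.translationNumber_mul_of_commute,
    CircleDeg1Lift.translationNumber_translate]
  rw [CircleDeg1Lift.commute_iff_commute]
  intro x
  simp

/-- The Euler cocycle may be computed with arbitrary lifts. -/
theorem eulerCocycle_eq {f h : HomeoPlus} {F H : CircleDeg1Liftˣ}
    (hF : IsLift (F : CircleDeg1Lift) f) (hH : IsLift (H : CircleDeg1Lift) h) :
    eulerCocycle f h = ((F * H : CircleDeg1Liftˣ) : CircleDeg1Lift).translationNumber
      - (F : CircleDeg1Lift).translationNumber - (H : CircleDeg1Lift).translationNumber := by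
  obtain ⟨m, hm⟩ := exists_int_of_isLift hF (isLift_someLift f)
  obtain ⟨n, hn⟩ := exists_int_of_isLift hH (isLift_someLift h)
  have hc : F * CircleDeg1Lift.translate (Multiplicative.ofAdd (n : ℝ)) =
      CircleDeg1Lift.translate (Multiplicative.ofAdd (n : ℝ)) * F := by
    ext x
    simp
  have hFH : someLift f * someLift h = CircleDeg1Lift.translate (Multiplicative.ofAdd (m : ℝ)) *
      (CircleDeg1Lift.translate (Multiplicative.ofAdd (n : ℝ)) * (F * H)) := by
    rw [hm, hn, mul_assoc, ← mul_assoc F, hc, mul_assoc]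
  unfold eulerCocycle
  rw [hFH, hm, hn]
  simp only [Units.val_mul, translationNumber_translate_mul]
  ring

lemma abs_eulerCocycle_le (f h : HomeoPlus) : |eulerCocycle f h| ≤ 4 := by
  unfold eulerCocycle
  generalize someLift f = F
  generalize someLift h = H
  have h1 := (F : CircleDeg1Lift).dist_map_zero_translationNumber_le
  have h2 := (H : CircleDeg1Lift).dist_map_zero_translationNumber_le
  have h3 := ((F * H : CircleDeg1Liftˣ) : CircleDeg1Lift).dist_map_zero_translationNumber_le
  have h4 := (F : CircleDeg1Lift).dist_map_map_zero_lt (H : CircleDeg1Lift)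
  simp only [Units.val_mul, CircleDeg1Lift.mul_apply, Real.dist_eq, abs_le, abs_lt] at *
  constructor <;> linarith [h1.1, h1.2, h2.1, h2.2, h3.1, h3.2, h4.1, h4.2]

section Actions

variable {G : Type*} [Group G]

/-- `φ(G)` has a common fixed point on the circle. -/
def HasGlobalFixedPoint (φ : G →* HomeoPlus) : Prop :=
  ∃ x : S1, ∀ g : G, φ g x = x

/-- Semiconjugacy of homomorphisms `G → Homeo₊(S¹)`: either both have a global fixed point, or
neither has one and some degree one monotone map `h` satisfies `φ₂(g) ∘ h = h ∘ φ₁(g)` for all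
`g`. -/
def Semiconjugate (φ₁ φ₂ : G →* HomeoPlus) : Prop :=
  (HasGlobalFixedPoint φ₁ ∧ HasGlobalFixedPoint φ₂) ∨
    (¬ HasGlobalFixedPoint φ₁ ∧ ¬ HasGlobalFixedPoint φ₂ ∧
      ∃ h : S1 → S1, IsDegreeOneMonotone h ∧ ∀ (g : G) (x : S1), φ₂ g (h x) = h (φ₁ g x))

/-- `φ` is of type `0`: there is a `φ(G)`-invariant (Borel) probability measure on the circle. -/
def IsTypeZero (φ : G →* HomeoPlus) : Prop :=
  ∃ μ : Measure S1, IsProbabilityMeasure μ ∧ ∀ g : G, μ.map (φ g) = μ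

/-- `φ` is minimal: the whole circle is a minimal set, i.e. the only nonempty closed
`φ(G)`-invariant subset. -/
def IsMinimalAction (φ : G →* HomeoPlus) : Prop :=
  ∀ F : Set S1, IsClosed F → F.Nonempty → (∀ g : G, φ g '' F = F) → F = Set.univ

/-- `φ'` is a minimal model of `φ`. -/
def IsMinimalModel (φ φ' : G →* HomeoPlus) : Prop :=
  IsMinimalAction φ' ∧ Semiconjugate φ φ'

/-- `ψ` is a `k`-fold lift of `φ`: `φ(g) ∘ π_k = π_k ∘ ψ(g)` for all `g`, where `π_k(x) = k x`. -/
def IsFoldLift (k : ℕ) (ψ φ : G →* HomeoPlus) : Prop :=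
  ∀ (g : G) (x : S1), φ g (k • x) = k • ψ g x

/-- `φ` is of type `k` (for `k ≥ 1`): it is not of type `0`, and `k` is the greatest among the
positive integers `m` such that a minimal model of `φ` is an `m`-fold lift of some homomorphism. -/
def IsOfType (k : ℕ) (φ : G →* HomeoPlus) : Prop :=
  ¬ IsTypeZero φ ∧
    IsGreatest {m : ℕ | 1 ≤ m ∧
      ∃ φ' : G →* HomeoPlus, IsMinimalModel φ φ' ∧ ∃ ψ : G →* HomeoPlus, IsFoldLift m φ' ψ} k

/-- The pulled back cocycle `φ^* c` on `G`. -/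
def pullbackEulerCocycle (φ : G →* HomeoPlus) (g₁ g₂ : G) : ℝ :=
  eulerCocycle (φ g₁) (φ g₂)

/-- The sup-norm of a real valued function of two variables in `G`. -/
def supNorm (b : G → G → ℝ) : ℝ :=
  ⨆ p : G × G, |b p.1 p.2|

/-- The supremum defining `‖φ^* c‖` is over a bounded set. -/
theorem bddAbove_pullbackEulerCocycle (φ : G →* HomeoPlus) :
    BddAbove (Set.range fun p : G × G => |pullbackEulerCocycle φ p.1 p.2|) := by
  refine ⟨4, ?_⟩
  rintro _ ⟨p, rfl⟩
  exact abs_eulerCocycle_le _ _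

end Actions

end CircleAction

end

noncomputable section

namespace CircleAction

open Set Filter Topology CircleDeg1Lift

/-! If `φ` preserves a probability measure, the translation number of a lift is the mean of its
displacement, hence additive on lifts, and the cocycle vanishes. So let `φ` be not of type 0. The
claim then reduces to one integer `k` for which some minimal model is a `k`-fold lift and the norm
is `1/k` (`exists_minimalModel_isFoldLift`).

Upper bound: `|c| ≤ 1` always (`abs_eulerCocycle_le_one`), an `m`-fold lift divides the cocycle by
`m`, and semiconjugacy preserves it. Hence a minimal model that is an `m`-fold lift forces norm at
most `1/m`. This also makes `k` the greatest admissible integer.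

Existence of `k`: collapsing the gaps of a minimal set gives a minimal factor
(`exists_minimal_factor`). If its lifts can contract no interval, they are conjugate into
translations and Lebesgue measure pulls back to an invariant measure, which is excluded
(`exists_equivariant_of_not_contractible`). Otherwise let `Θ x` be the supremum of the `y` with `[x,
y]` contractible. Then `Θ` is a homeomorphism centralizing the action, and `Θ ^ k` is the unit
translation for some `k` (`exists_centralizing_of_contractible`). Conjugating `Θ` to the translation
by `1/k` exhibits a `k`-fold lift (`exists_conj_isFoldLift`).

Lower bound: contracting intervals by ping-pong gives lifts `F`, `H` with nonpositive translation
numbers and `F H 0 ≥ Θ 0`, so that `τ(F H) ≥ 1/k` (`exists_translationNumber_of_contractible`). -/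

lemma units_continuous (F : CircleDeg1Liftˣ) : Continuous (F : ℝ → ℝ) :=
  (toOrderIso F).continuous

lemma units_strictMono (F : CircleDeg1Liftˣ) : StrictMono (F : ℝ → ℝ) :=
  (toOrderIso F).strictMono

lemma units_mul_apply (F H : CircleDeg1Liftˣ) (x : ℝ) : (F * H : CircleDeg1Liftˣ) x = F (H x) :=
  rfl

lemma units_ext {F H : CircleDeg1Liftˣ} (h : ∀ x, F x = H x) : F = H :=
  Units.ext (CircleDeg1Lift.ext h)

/-! ### The bound `|c| ≤ 1` -/

lemma translationNumber_le_map_sub_add_one (f : CircleDeg1Lift) (x : ℝ) :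
    f.translationNumber ≤ f x - x + 1 :=
  (f.translationNumber_le_ceil_sub x).trans (Int.ceil_lt_add_one _).le

/-- The average of the first `n` iterates of a lift. -/
def iterateAverage (f : CircleDeg1Lift) (n : ℕ) (hn : 0 < n) : CircleDeg1Lift where
  toFun x := (∑ i ∈ Finset.range n, (f ^ i) x) / n
  monotone' x y hxy := by
    have : ∑ i ∈ Finset.range n, (f ^ i) x ≤ ∑ i ∈ Finset.range n, (f ^ i) y :=
      Finset.sum_le_sum fun i _ => (f ^ i).monotone hxy
    simp only
    gcongr
  map_add_one' x := by
    have : (n : ℝ) ≠ 0 := by positivity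
    simp only [map_add_one, Finset.sum_add_distrib, Finset.sum_const, Finset.card_range]
    field_simp
    simp

lemma iterateAverage_apply (f : CircleDeg1Lift) (n : ℕ) (hn : 0 < n) (x : ℝ) :
    iterateAverage f n hn x = (∑ i ∈ Finset.range n, (f ^ i) x) / n := rfl

/-- Averaging iterates gives a change of coordinates in which `F` is close to a translation. -/
lemma exists_units_map_eq_add (F : CircleDeg1Liftˣ) (n : ℕ) (hn : 0 < n) :
    ∃ K : CircleDeg1Liftˣ, ∀ x, K (F x) = K x + ((F ^ n : CircleDeg1Liftˣ) x - x) / n := by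
  have hpow : ∀ i : ℕ, ((F : CircleDeg1Lift) ^ i) = ((F ^ i : CircleDeg1Liftˣ) : CircleDeg1Lift) :=
    fun i => (Units.val_pow_eq_pow_val F i).symm
  have hmono : StrictMono (iterateAverage F n hn) := by
    intro x y hxy
    rw [iterateAverage_apply, iterateAverage_apply]
    refine div_lt_div_of_pos_right ?_ (by positivity)
    refine Finset.sum_lt_sum_of_nonempty (Finset.nonempty_range_iff.2 hn.ne') fun i _ => ?_
    rw [hpow]
    exact units_strictMono _ hxy
  have hcont : Continuous (iterateAverage F n hn) := by
    have : (iterateAverage F n hn : ℝ → ℝ) =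
        fun x => (∑ i ∈ Finset.range n, ((F : CircleDeg1Lift) ^ i) x) / n := rfl
    rw [this]
    refine Continuous.div_const (continuous_finsetSum _ fun i _ => ?_) _
    rw [hpow]
    exact units_continuous _
  obtain ⟨K, hK⟩ := isUnit_iff_bijective.2 ⟨hmono.injective, continuous_iff_surjective _ |>.1 hcont⟩
  refine ⟨K, fun x => ?_⟩
  rw [hK, iterateAverage_apply, iterateAverage_apply, ← add_div]
  congr 1
  have e : ∀ i : ℕ, ((F : CircleDeg1Lift) ^ i) (F x) = ((F : CircleDeg1Lift) ^ (i + 1)) x := by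
    intro i
    rw [pow_succ, mul_apply]
  simp only [e]
  have h1 := Finset.sum_range_succ (fun i => ((F : CircleDeg1Lift) ^ i) x) n
  rw [Finset.sum_range_succ'] at h1
  simp only [pow_zero, coe_one, id] at h1
  rw [Units.val_pow_eq_pow_val]
  linarith

/-- Up to conjugation `F` displaces every point by at most `τ(F) + 1/n`, while the conjugate of `H`
displaces some point by exactly `τ(H)`. At that point the product moves by at most `τ(F) + τ(H) +
1/n`, and a translation number exceeds the displacement of any single point by at most 1. Let `n`
tend to infinity. -/
lemma translationNumber_mul_le (F H : CircleDeg1Liftˣ) :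
    ((F * H : CircleDeg1Liftˣ) : CircleDeg1Lift).translationNumber ≤
      (F : CircleDeg1Lift).translationNumber + (H : CircleDeg1Lift).translationNumber + 1 := by
  refine le_of_forall_pos_le_add fun ε hε => ?_
  obtain ⟨m, hm⟩ := exists_nat_one_div_lt hε
  obtain ⟨K, hK⟩ := exists_units_map_eq_add F (m + 1) m.succ_pos
  obtain ⟨x, hx⟩ := exists_eq_add_translationNumber _ (units_continuous (K * H * K⁻¹))
  have h1 := translationNumber_le_map_sub_add_one
    ((K * (F * H) * K⁻¹ : CircleDeg1Liftˣ) : CircleDeg1Lift) x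
  have c1 := translationNumber_conj_eq K (F * H : CircleDeg1Liftˣ)
  have c2 := translationNumber_conj_eq K H
  simp only [Units.val_mul] at h1 c1 c2 hx ⊢
  rw [c1] at h1
  rw [c2] at hx
  simp only [mul_apply] at h1 hx
  rw [hK, hx] at h1
  have h2 := map_lt_add_translationNumber_add_one ((F ^ (m + 1) : CircleDeg1Liftˣ) : CircleDeg1Lift)
    ((H : CircleDeg1Lift) (((K⁻¹ : CircleDeg1Liftˣ) : CircleDeg1Lift) x))
  rw [Units.val_pow_eq_pow_val, translationNumber_pow, ← Units.val_pow_eq_pow_val] at h2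
  set A := ((F ^ (m + 1) : CircleDeg1Liftˣ) : CircleDeg1Lift)
    ((H : CircleDeg1Lift) (((K⁻¹ : CircleDeg1Liftˣ) : CircleDeg1Lift) x)) -
    (H : CircleDeg1Lift) (((K⁻¹ : CircleDeg1Liftˣ) : CircleDeg1Lift) x) with hA
  have h3 : A / ((m + 1 : ℕ) : ℝ) ≤ (F : CircleDeg1Lift).translationNumber + 1 / ((m : ℝ) + 1) := by
    have hp : (0 : ℝ) < (m : ℝ) + 1 := by positivity
    rw [Units.val_pow_eq_pow_val] at hA
    push_cast at h2 ⊢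
    rw [div_le_iff₀ hp, add_mul, one_div_mul_cancel hp.ne']
    linarith
  linarith

theorem abs_eulerCocycle_le_one (f h : HomeoPlus) : |eulerCocycle f h| ≤ 1 := by
  unfold eulerCocycle
  generalize someLift f = F
  generalize someLift h = H
  have h1 := translationNumber_mul_le F H
  -- Inverses negate `τ`, which turns the upper bound into the lower one.
  have h2 := translationNumber_mul_le H⁻¹ F⁻¹
  rw [← mul_inv_rev] at h2
  simp only [translationNumber_units_inv] at h2
  rw [abs_le]
  constructor <;> linarith

/-- Every orbit of `Γ` on the line is dense. -/
def IsMinimalOnLine (Γ : Subgroup CircleDeg1Liftˣ) : Prop :=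
  ∀ x a b : ℝ, a < b → ∃ F ∈ Γ, F x ∈ Ioo a b

/-- The interval `[x, y]` can be made arbitrarily short by elements of `Γ`. -/
def Contractible (Γ : Subgroup CircleDeg1Liftˣ) (x y : ℝ) : Prop :=
  ∀ ε > 0, ∃ F ∈ Γ, F y - F x < ε

lemma units_coe_pow (F : CircleDeg1Liftˣ) (n : ℕ) :
    (((F ^ n : CircleDeg1Liftˣ) : CircleDeg1Lift) : ℝ → ℝ) = (F : ℝ → ℝ)^[n] := by
  rw [Units.val_pow_eq_pow_val, coe_pow]

/-! ### Centralizers of minimal groups of lifts -/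

section Minimal

variable {Γ : Subgroup CircleDeg1Liftˣ}

/-- The range of `L` is invariant, hence dense, so the monotone map `L` is continuous. If `L` were
constant on some interval, minimality would carry every point into it and `L` would be locally
constant, against degree one. -/
lemma IsMinimalOnLine.exists_units_of_commute (hΓ : IsMinimalOnLine Γ) (L : CircleDeg1Lift)
    (hL : ∀ F ∈ Γ, ∀ x, L (F x) = F (L x)) : ∃ Θ : CircleDeg1Liftˣ, (Θ : CircleDeg1Lift) = L := by
  have hcont : Continuous L := by
    refine L.monotone.continuous_of_denseRange (dense_of_exists_between fun a b hab => ?_)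
    obtain ⟨F, hF, h1, h2⟩ := hΓ (L 0) a b hab
    exact ⟨_, ⟨F 0, hL F hF 0⟩, h1, h2⟩
  have hinj : ∀ x y, x < y → L x ≠ L y := by
    intro x y hxy h
    have hloc : IsLocallyConstant L := by
      rw [IsLocallyConstant.iff_eventually_eq]
      intro z
      obtain ⟨F, hF, hz⟩ := hΓ z x y hxy
      have hev : ∀ᶠ w in 𝓝 z, F w ∈ Ioo x y :=
        (units_continuous F).continuousAt.eventually_mem (isOpen_Ioo.mem_nhds hz)
      have key : ∀ w, F w ∈ Ioo x y → F (L w) = L x := by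
        intro w hw
        rw [← hL F hF]
        exact le_antisymm ((L.monotone hw.2.le).trans h.ge) (L.monotone hw.1.le)
      filter_upwards [hev] with w hw
      exact (units_strictMono F).injective ((key w hw).trans (key z hz).symm)
    have h1 := hloc.apply_eq_of_isPreconnected isPreconnected_univ (mem_univ (0 + 1)) (mem_univ 0)
    rw [L.map_add_one] at h1
    linarith
  refine isUnit_iff_bijective.2 ⟨fun x y h => ?_, continuous_iff_surjective _ |>.1 hcont⟩
  by_contra hne
  rcases lt_or_gt_of_ne hne with h' | h'
  · exact hinj _ _ h' h
  · exact hinj _ _ h' h.symm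

lemma IsMinimalOnLine.eq_one_of_commute (hΓ : IsMinimalOnLine Γ) (Θ : CircleDeg1Liftˣ)
    (hΘ : ∀ F ∈ Γ, ∀ x, Θ (F x) = F (Θ x)) {z : ℝ} (hz : Θ z = z) : Θ = 1 := by
  have hclosed : IsClosed {x | Θ x = x} := isClosed_eq (units_continuous Θ) continuous_id
  have hdense : Dense {x | Θ x = x} := by
    refine dense_of_exists_between fun a b hab => ?_
    obtain ⟨F, hF, h1, h2⟩ := hΓ z a b hab
    refine ⟨F z, ?_, h1, h2⟩
    rw [mem_ofPred_eq, hΘ F hF, hz]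
  have huniv := hdense.closure_eq
  rw [hclosed.closure_eq] at huniv
  exact units_ext fun x => (huniv ▸ mem_univ x : x ∈ {x | Θ x = x})

/-- The source of both centralizing homeomorphisms below. Applying `hinv` to `F` and to `F⁻¹` gives
`S (F x) = F (S x)`, and increasing bijections commute with suprema. -/
lemma IsMinimalOnLine.exists_units_eq_sSup (hΓ : IsMinimalOnLine Γ)
    (hZ : translate (Multiplicative.ofAdd (1 : ℝ)) ∈ Γ) (S : ℝ → Set ℝ)
    (hne : ∀ x, (S x).Nonempty) (hbdd : ∀ x, BddAbove (S x))
    (hmono : ∀ x x', x ≤ x' → S x ⊆ S x') (hinv : ∀ F ∈ Γ, ∀ x, ∀ y ∈ S x, F y ∈ S (F x)) :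
    ∃ Θ : CircleDeg1Liftˣ, (∀ x, Θ x = sSup (S x)) ∧ ∀ F ∈ Γ, ∀ x, Θ (F x) = F (Θ x) := by
  have himage : ∀ F ∈ Γ, ∀ x, sSup (S (F x)) = F (sSup (S x)) := by
    intro F hF x
    have h1 : S (F x) = toOrderIso F '' S x := by
      ext y
      constructor
      · intro hy
        refine ⟨F⁻¹ y, ?_, units_apply_inv_apply F y⟩
        have := hinv F⁻¹ (Γ.inv_mem hF) _ _ hy
        rwa [units_inv_apply_apply] at this
      · rintro ⟨w, hw, rfl⟩
        exact hinv F hF _ _ hw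
    rw [h1, ← (toOrderIso F).map_csSup' (hne x) (hbdd x)]
    rfl
  let L : CircleDeg1Lift :=
    { toFun := fun x => sSup (S x)
      monotone' := fun x x' h => csSup_le_csSup (hbdd x') (hne x) (hmono x x' h)
      map_add_one' := fun x => by
        have := himage _ hZ x
        simpa [add_comm] using this }
  obtain ⟨Θ, hΘ⟩ := hΓ.exists_units_of_commute L himage
  refine ⟨Θ, fun x => by rw [hΘ]; rfl, fun F hF x => ?_⟩
  rw [hΘ]
  exact himage F hF x

lemma translate_neg_floor_apply (x : ℝ) :
    translate (Multiplicative.ofAdd ((-⌊x⌋ : ℤ) : ℝ)) x = Int.fract x := by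
  rw [translate_apply, ← Int.self_sub_floor]
  push_cast
  ring

/-! ### Groups with a contractible interval -/

section Contracting

variable (hΓ : IsMinimalOnLine Γ) (hZ : ∀ n : ℤ, translate (Multiplicative.ofAdd (n : ℝ)) ∈ Γ)

include hΓ hZ

/-- By minimality the preimages of `(u, v)` cover `[0, 1]`. Shrink `[x, y]` below a Lebesgue number
of this cover, translate its left end into `[0, 1)`, then apply the element attached to that place.
-/
lemma exists_mem_Ioo_of_contractible {x y u v : ℝ} (hxy : x ≤ y) (h : Contractible Γ x y)
    (huv : u < v) : ∃ F ∈ Γ, u < F x ∧ F y < v := by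
  obtain ⟨δ, hδ, hcover⟩ := lebesgue_number_lemma_of_metric (s := Icc (0 : ℝ) 1)
    (c := fun F : Γ => (F : CircleDeg1Liftˣ) ⁻¹' Ioo u v) isCompact_Icc
    (fun F => isOpen_Ioo.preimage (units_continuous _)) (by
      intro w _
      obtain ⟨F, hF, hw⟩ := hΓ w u v huv
      exact mem_iUnion.2 ⟨⟨F, hF⟩, hw⟩)
  obtain ⟨F, hF, hFxy⟩ := h δ hδ
  let T : CircleDeg1Liftˣ := translate (Multiplicative.ofAdd ((-⌊F x⌋ : ℤ) : ℝ))
  have hTx : T (F x) = Int.fract (F x) := translate_neg_floor_apply _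
  have hTy : T (F y) = Int.fract (F x) + (F y - F x) := by
    rw [← hTx]
    simp only [T, translate_apply]
    ring
  obtain ⟨E, hE⟩ := hcover (Int.fract (F x)) ⟨Int.fract_nonneg _, (Int.fract_lt_one _).le⟩
  refine ⟨E * (T * F), Γ.mul_mem E.2 (Γ.mul_mem (hZ _) hF), ?_, ?_⟩
  · rw [units_mul_apply, units_mul_apply, hTx]
    exact (hE (Metric.mem_ball_self hδ)).1
  · rw [units_mul_apply, units_mul_apply, hTy]
    refine (hE ?_).2
    have := (F : CircleDeg1Lift).monotone hxy
    rw [Metric.mem_ball, Real.dist_eq, add_sub_cancel_left, abs_of_nonneg (by linarith)]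
    exact hFxy

/-- `Θ x` is the supremum of the `y` with `[x, y]` contractible. Contractible intervals are shorter
than 1, and minimality spreads contractibility to every starting point, so `x < Θ x ≤ x + 1`. -/
lemma exists_centralizing_of_contractible {x₀ y₀ : ℝ} (h0 : x₀ < y₀) (h : Contractible Γ x₀ y₀) :
    ∃ (Θ : CircleDeg1Liftˣ) (k : ℕ), 1 ≤ k ∧ (∀ F ∈ Γ, ∀ x, Θ (F x) = F (Θ x)) ∧
      (∀ x, x < Θ x) ∧ Θ ^ k = translate (Multiplicative.ofAdd (1 : ℝ)) ∧
      ∀ x y, y < Θ x → Contractible Γ x y := by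
  have hZ1 : translate (Multiplicative.ofAdd (1 : ℝ)) ∈ Γ := by simpa using hZ 1
  have hinv : ∀ F ∈ Γ, ∀ x y, Contractible Γ x y → Contractible Γ (F x) (F y) := by
    intro F hF x y hxy ε hε
    obtain ⟨E, hE, h1⟩ := hxy ε hε
    refine ⟨E * F⁻¹, Γ.mul_mem hE (Γ.inv_mem hF), ?_⟩
    simpa only [units_mul_apply, units_inv_apply_apply] using h1
  have hleft : ∀ x x' y, x ≤ x' → Contractible Γ x y → Contractible Γ x' y := by
    intro x x' y hx hxy ε hε
    obtain ⟨E, hE, h1⟩ := hxy ε hε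
    exact ⟨E, hE, by linarith [(E : CircleDeg1Lift).monotone hx]⟩
  have hright : ∀ x y y', y' ≤ y → Contractible Γ x y → Contractible Γ x y' := by
    intro x y y' hy hxy ε hε
    obtain ⟨E, hE, h1⟩ := hxy ε hε
    exact ⟨E, hE, by linarith [(E : CircleDeg1Lift).monotone hy]⟩
  have hbd : ∀ x y, Contractible Γ x y → y < x + 1 := by
    intro x y hxy
    obtain ⟨E, hE, h1⟩ := hxy 1 one_pos
    rw [← (units_strictMono E).lt_iff_lt, map_add_one]
    linarith
  have hpos : ∀ x, ∃ y, x < y ∧ Contractible Γ x y := by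
    intro x
    obtain ⟨F, hF, h1, h2⟩ := hΓ x x₀ y₀ h0
    refine ⟨F⁻¹ y₀, ?_, ?_⟩
    · rw [← (units_strictMono F).lt_iff_lt, units_apply_inv_apply]
      exact h2
    · have := hinv F⁻¹ (Γ.inv_mem hF) _ _ (hleft _ _ _ h1.le h)
      rwa [units_inv_apply_apply] at this
  have hbdd : ∀ x, BddAbove {y | Contractible Γ x y} := fun x => ⟨x + 1, fun y hy => (hbd x y hy).le⟩
  have hne : ∀ x, {y | Contractible Γ x y}.Nonempty := fun x => by
    obtain ⟨y, _, hy⟩ := hpos x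
    exact ⟨y, hy⟩
  obtain ⟨Θ, hΘ, hcomm⟩ := hΓ.exists_units_eq_sSup hZ1 (fun x => {y | Contractible Γ x y}) hne hbdd
    (fun x x' hx y hy => hleft x x' y hx hy) (fun F hF x y hy => hinv F hF x y hy)
  have hlt : ∀ x, x < Θ x := by
    intro x
    obtain ⟨y, hxy, hy⟩ := hpos x
    rw [hΘ]
    exact hxy.trans_le (le_csSup (hbdd x) hy)
  have hle : ∀ x, Θ x ≤ x + 1 := by
    intro x
    rw [hΘ]
    exact csSup_le (hne x) fun y hy => (hbd x y hy).le
  have hcontr : ∀ x y, y < Θ x → Contractible Γ x y := by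
    intro x y hy
    rw [hΘ] at hy
    obtain ⟨w, hw, hyw⟩ := exists_lt_of_lt_csSup (hne x) hy
    exact hright _ _ _ hyw.le hw
  have hex : ∃ n : ℕ, 1 < (Θ : ℝ → ℝ)^[n] 0 := by
    by_contra hcon
    push Not at hcon
    have hm : Monotone fun n : ℕ => (Θ : ℝ → ℝ)^[n] 0 := by
      refine monotone_nat_of_le_succ fun n => ?_
      rw [Function.iterate_succ_apply']
      exact (hlt _).le
    have ht := tendsto_atTop_ciSup hm ⟨1, by rintro _ ⟨n, rfl⟩; exact hcon n⟩
    have := isFixedPt_of_tendsto_iterate ht (units_continuous Θ).continuousAt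
    exact (hlt _).ne' this
  classical
  -- The choice of `k` is `Θ^k 0 ≤ 1 < Θ^(k+1) 0`.
  obtain ⟨k, hk⟩ : ∃ k, Nat.find hex = k + 1 := by
    refine Nat.exists_eq_succ_of_ne_zero fun h0 => ?_
    have := Nat.find_spec hex
    rw [h0] at this
    norm_num at this
  have hk1 : 1 < Θ ((Θ : ℝ → ℝ)^[k] 0) := by
    have := Nat.find_spec hex
    rwa [hk, Function.iterate_succ_apply'] at this
  have hk2 : (Θ : ℝ → ℝ)^[k] 0 ≤ 1 := not_lt.1 (Nat.find_min hex (by omega))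
  have hk0 : 1 ≤ k := by
    rcases Nat.eq_zero_or_pos k with h' | h'
    · rw [h'] at hk1
      have := hle 0
      simp only [Function.iterate_zero, id] at hk1
      linarith
    · exact h'
  have hcommk : ∀ F ∈ Γ, ∀ x, (Θ ^ k : CircleDeg1Liftˣ) (F x) = F ((Θ ^ k : CircleDeg1Liftˣ) x) := by
    intro F hF x
    rw [units_coe_pow]
    exact Function.Commute.iterate_left (f := (Θ : ℝ → ℝ)) (g := (F : ℝ → ℝ)) (hcomm F hF) k x
  -- It suffices that `τ(Θ^k) = 1`. If `τ(Θ^k) < 1`, the gap from `Θ^k x` to `x + 1` is positive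
  -- with a minimum at some `w`. But `[Θ^k 0, 1]` is contractible since `1 < Θ (Θ^k 0)`, and its
  -- image under `F` is the gap at `x = F 0`, which can be made smaller than the minimum.
  obtain ⟨z, hz⟩ : ∃ z, (Θ ^ k : CircleDeg1Liftˣ) z = z + (1 : ℤ) := by
    rw [← translationNumber_eq_int_iff _ (units_continuous _)]
    refine le_antisymm (translationNumber_le_of_le_add_int _ (x := 0) ?_) (not_lt.1 fun hτ => ?_)
    · rw [units_coe_pow]
      simpa using hk2
    have hall := map_lt_of_translationNumber_lt_int _ hτ
    obtain ⟨w, -, hw⟩ := isCompact_Icc.exists_isMinOn (s := Icc (0 : ℝ) 1) (by simp)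
      (f := fun w => w + 1 - (Θ ^ k : CircleDeg1Liftˣ) w)
      (((continuous_id.add continuous_const).sub (units_continuous _)).continuousOn)
    have hmin : ∀ x, (Θ ^ k : CircleDeg1Liftˣ) x - x ≤ (Θ ^ k : CircleDeg1Liftˣ) w - w := by
      refine forall_map_sub_of_Icc _ (fun t => t ≤ (Θ ^ k : CircleDeg1Liftˣ) w - w) fun x hx => ?_
      have := isMinOn_iff.1 hw x hx
      linarith
    have hw1 := hall w
    rw [Int.cast_one] at hw1
    obtain ⟨F, hF, hF1⟩ := hcontr _ _ hk1 (w + 1 - (Θ ^ k : CircleDeg1Liftˣ) w) (by linarith)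
    rw [← units_coe_pow, ← hcommk F hF] at hF1
    have h2 := hmin (F 0)
    have h3 := (F : CircleDeg1Lift).map_add_one 0
    rw [zero_add] at h3
    linarith
  refine ⟨Θ, k, hk0, hcomm, hlt, ?_, hcontr⟩
  rw [← inv_mul_eq_one]
  refine hΓ.eq_one_of_commute _ (fun F hF x => ?_) (z := z + 1) ?_
  · rw [units_mul_apply, units_mul_apply, ← units_strictMono (Θ ^ k) |>.injective.eq_iff,
      units_apply_inv_apply, hcommk F hF, units_apply_inv_apply]
    simp
  · rw [units_mul_apply, ← units_strictMono (Θ ^ k) |>.injective.eq_iff,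
      units_apply_inv_apply, CircleDeg1Lift.translate_apply, map_add_one, hz, Int.cast_one]
    ring

/-- Take `0 < b < a < d < Θ 0`. `H` squeezes `[0, d]` into `(a, d)` and `F` squeezes `[a, Θ b]` into
`(Θ 0, Θ b)`. Each moves a right endpoint to the left, so neither has positive translation number.
Yet `F H 0 ≥ F a > Θ 0`, and commuting with `Θ` gives `(F H)^k 0 ≥ Θ^k 0 = 1`. -/
lemma exists_translationNumber_of_contractible {Θ : CircleDeg1Liftˣ} {k : ℕ} (hk : 1 ≤ k)
    (hcomm : ∀ F ∈ Γ, ∀ x, Θ (F x) = F (Θ x)) (hlt : ∀ x, x < Θ x)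
    (hpow : Θ ^ k = translate (Multiplicative.ofAdd (1 : ℝ)))
    (hcontr : ∀ x y, y < Θ x → Contractible Γ x y) :
    ∃ F ∈ Γ, ∃ H ∈ Γ, (F : CircleDeg1Lift).translationNumber ≤ 0 ∧
      (H : CircleDeg1Lift).translationNumber ≤ 0 ∧
      1 / (k : ℝ) ≤ ((F * H : CircleDeg1Liftˣ) : CircleDeg1Lift).translationNumber := by
  obtain ⟨d, hd0, hd⟩ := exists_between (hlt 0)
  obtain ⟨a, ha0, had⟩ := exists_between hd0
  obtain ⟨b, hb0, hba⟩ := exists_between ha0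
  have hΘb : Θ 0 < Θ b := units_strictMono Θ hb0
  obtain ⟨H, hH, hH1, hH2⟩ := exists_mem_Ioo_of_contractible hΓ hZ hd0.le (hcontr _ _ hd) had
  obtain ⟨F, hF, hF1, hF2⟩ := exists_mem_Ioo_of_contractible hΓ hZ (x := a) (y := Θ b)
    (by linarith) (hcontr _ _ (units_strictMono Θ hba)) hΘb
  refine ⟨F, hF, H, hH, ?_, ?_, ?_⟩
  · have := translationNumber_le_of_le_add_int (F : CircleDeg1Lift) (x := Θ b) (m := 0)
      (by simpa using hF2.le)
    simpa using this
  · have := translationNumber_le_of_le_add_int (H : CircleDeg1Lift) (x := d) (m := 0)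
      (by simpa using hH2.le)
    simpa using this
  · have hp : Θ 0 ≤ (F * H : CircleDeg1Liftˣ) 0 := by
      rw [units_mul_apply]
      exact hF1.le.trans ((F : CircleDeg1Lift).monotone hH1.le)
    have hcommL : Function.Commute (Θ : ℝ → ℝ) ((F * H : CircleDeg1Liftˣ) : CircleDeg1Lift) :=
      hcomm _ (Γ.mul_mem hF hH)
    have hiter := hcommL.iterate_le_of_map_le (Θ : CircleDeg1Lift).monotone
      ((F * H : CircleDeg1Liftˣ) : CircleDeg1Lift).monotone hp k
    rw [← units_coe_pow, hpow, ← units_coe_pow, CircleDeg1Lift.translate_apply] at hiter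
    have h1 := le_translationNumber_of_add_int_le
      (((F * H) ^ k : CircleDeg1Liftˣ) : CircleDeg1Lift) (x := 0) (m := 1) (by
        rw [Int.cast_one]; linarith)
    rw [Units.val_pow_eq_pow_val, translationNumber_pow, Int.cast_one] at h1
    rw [div_le_iff₀ (by positivity)]
    linarith

end Contracting

end Minimal

/-! ### Groups without contractible intervals -/

section Equicontinuous

variable {Γ : Subgroup CircleDeg1Liftˣ}

/-- For `w` near `x` the interval `[w, w + η]` contains the middle third of `[x, x + η]`, so the
bound at `x` is locally uniform. Compactness of `[0, 1]` and periodicity do the rest. -/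
lemma exists_forall_le_map_add_sub (h : ∀ x y, x < y → ¬ Contractible Γ x y) {η : ℝ} (hη : 0 < η) :
    ∃ δ > 0, ∀ x, ∀ F ∈ Γ, δ ≤ F (x + η) - F x := by
  have hcompact : ∃ δ > 0, ∀ x ∈ Icc (0 : ℝ) 1, ∀ F ∈ Γ, δ ≤ F (x + η) - F x := by
    refine isCompact_Icc.induction_on
      (p := fun s : Set ℝ => ∃ δ > 0, ∀ x ∈ s, ∀ F ∈ Γ, δ ≤ F (x + η) - F x) ?_ ?_ ?_ ?_
    · exact ⟨1, one_pos, fun x hx => hx.elim⟩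
    · rintro s t hst ⟨δ, hδ, ht⟩
      exact ⟨δ, hδ, fun x hx => ht x (hst hx)⟩
    · rintro s t ⟨δ, hδ, hs⟩ ⟨δ', hδ', ht⟩
      refine ⟨min δ δ', lt_min hδ hδ', fun x hx F hF => ?_⟩
      rcases hx with hx | hx
      · exact (min_le_left _ _).trans (hs x hx F hF)
      · exact (min_le_right _ _).trans (ht x hx F hF)
    · intro x _
      have hx := h (x + η / 3) (x + 2 * η / 3) (by linarith)
      unfold Contractible at hx
      push Not at hx
      obtain ⟨δ, hδ, hF⟩ := hx
      refine ⟨Ioo (x - η / 3) (x + η / 3), mem_nhdsWithin_of_mem_nhds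
        (Ioo_mem_nhds (by linarith) (by linarith)), δ, hδ, fun w hw F hFΓ => ?_⟩
      have h1 := hF F hFΓ
      have h2 : F w ≤ F (x + η / 3) := (F : CircleDeg1Lift).monotone hw.2.le
      have h3 : F (x + 2 * η / 3) ≤ F (w + η) :=
        (F : CircleDeg1Lift).monotone (by linarith [hw.1])
      linarith
  obtain ⟨δ, hδ, hc⟩ := hcompact
  refine ⟨δ, hδ, fun x F hF => ?_⟩
  have h1 := hc (Int.fract x) ⟨Int.fract_nonneg _, (Int.fract_lt_one _).le⟩ F hF
  have h2 : Int.fract x + η = x + η - ⌊x⌋ := by rw [← Int.self_sub_floor]; ring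
  rw [h2, ← Int.self_sub_floor, map_sub_int, map_sub_int] at h1
  linarith

/-- `σ x` is the supremum of the `y` such that some `F ∈ Γ` makes `[x, y]` shorter than `δ`. The
identity shows `σ x ≥ x + δ/2`, and the uniform lower bound shows `σ x ≤ x + η`. -/
lemma exists_small_centralizing (hΓ : IsMinimalOnLine Γ)
    (hZ : translate (Multiplicative.ofAdd (1 : ℝ)) ∈ Γ)
    (h : ∀ x y, x < y → ¬ Contractible Γ x y) {η : ℝ} (hη : 0 < η) :
    ∃ σ : CircleDeg1Liftˣ, ∃ δ > 0, (∀ F ∈ Γ, ∀ x, σ (F x) = F (σ x)) ∧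
      (∀ x, x + δ ≤ σ x) ∧ ∀ x, σ x ≤ x + η := by
  obtain ⟨δ, hδ, hδF⟩ := exists_forall_le_map_add_sub h hη
  have hmem : ∀ x, ∀ y ∈ {y | ∃ F ∈ Γ, F y - F x < δ}, y ≤ x + η := by
    rintro x y ⟨F, hF, hFy⟩
    have := hδF x F hF
    refine ((units_strictMono F).lt_iff_lt.1 ?_).le
    linarith
  have hδmem : ∀ x, x + δ / 2 ∈ {y | ∃ F ∈ Γ, F y - F x < δ} := fun x =>
    ⟨1, Γ.one_mem, by simp only [Units.val_one, coe_one, id]; linarith⟩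
  obtain ⟨σ, hσ, hcomm⟩ := hΓ.exists_units_eq_sSup hZ (fun x => {y | ∃ F ∈ Γ, F y - F x < δ})
    (fun x => ⟨_, hδmem x⟩) (fun x => ⟨x + η, hmem x⟩) (by
      rintro x x' hx y ⟨F, hF, hFy⟩
      exact ⟨F, hF, by linarith [(F : CircleDeg1Lift).monotone hx]⟩) (by
      rintro F hF x y ⟨E, hE, hEy⟩
      refine ⟨E * F⁻¹, Γ.mul_mem hE (Γ.inv_mem hF), ?_⟩
      simpa only [units_mul_apply, units_inv_apply_apply] using hEy)
  refine ⟨σ, δ / 2, by positivity, hcomm, fun x => ?_, fun x => ?_⟩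
  · rw [hσ]
    exact le_csSup ⟨x + η, hmem x⟩ (hδmem x)
  · rw [hσ]
    exact csSup_le ⟨_, hδmem x⟩ (hmem x)

lemma add_mul_le_pow_apply {σ : CircleDeg1Liftˣ} {δ : ℝ} (h : ∀ x, x + δ ≤ σ x) (n : ℕ) (x : ℝ) :
    x + n * δ ≤ (σ ^ n : CircleDeg1Liftˣ) x := by
  induction n with
  | zero => simp
  | succ n ih =>
    rw [pow_succ', units_mul_apply]
    have := h ((σ ^ n : CircleDeg1Liftˣ) x)
    push_cast at this ih ⊢
    linarith

lemma pow_apply_le_add_mul {σ : CircleDeg1Liftˣ} {η : ℝ} (h : ∀ x, σ x ≤ x + η) (n : ℕ) (x : ℝ) :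
    (σ ^ n : CircleDeg1Liftˣ) x ≤ x + n * η := by
  induction n with
  | zero => simp
  | succ n ih =>
    rw [pow_succ', units_mul_apply]
    have := h ((σ ^ n : CircleDeg1Liftˣ) x)
    push_cast at this ih ⊢
    linarith

lemma zpow_apply_strictMono {σ : CircleDeg1Liftˣ} {δ : ℝ} (hδ : 0 < δ) (h : ∀ x, x + δ ≤ σ x)
    (x : ℝ) : StrictMono fun m : ℤ => (σ ^ m : CircleDeg1Liftˣ) x := by
  refine strictMono_int_of_lt_succ fun m => ?_
  rw [add_comm, zpow_add, zpow_one, units_mul_apply]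
  linarith [h ((σ ^ m : CircleDeg1Liftˣ) x)]

/-- Counting the points of a `σ`-orbit below `x`. -/
lemma exists_orbit_count {σ : CircleDeg1Liftˣ} {δ : ℝ} (hδ : 0 < δ) (h : ∀ x, x + δ ≤ σ x) (x : ℝ) :
    ∃ m : ℤ, (σ ^ m : CircleDeg1Liftˣ) 0 ≤ x ∧ x < (σ ^ (m + 1) : CircleDeg1Liftˣ) 0 := by
  have hmono := zpow_apply_strictMono hδ h 0
  obtain ⟨n, hn⟩ := exists_nat_gt (|x| / δ)
  rw [div_lt_iff₀ hδ] at hn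
  have hup : x < (σ ^ (n : ℤ) : CircleDeg1Liftˣ) 0 := by
    have := add_mul_le_pow_apply h n 0
    rw [zpow_natCast]
    linarith [le_abs_self x]
  have hdown : (σ ^ (-(n : ℤ)) : CircleDeg1Liftˣ) 0 ≤ x := by
    have := add_mul_le_pow_apply h n ((σ ^ (-(n : ℤ)) : CircleDeg1Liftˣ) 0)
    rw [← units_mul_apply, zpow_neg, zpow_natCast, mul_inv_cancel] at this
    simp only [Units.val_one, coe_one, id] at this
    rw [zpow_neg, zpow_natCast]
    linarith [neg_abs_le x]
  obtain ⟨m, hm, hmax⟩ := Int.exists_greatest_of_bdd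
    (P := fun m : ℤ => (σ ^ m : CircleDeg1Liftˣ) 0 ≤ x)
    ⟨n, fun z hz => (hmono.lt_iff_lt.1 (hz.trans_lt hup)).le⟩ ⟨_, hdown⟩
  refine ⟨m, hm, not_le.1 fun hcon => ?_⟩
  have := hmax _ hcon
  omega

/-- Let `N x` count the points of the `σ`-orbit of 0 up to `x`. Since `Γ` commutes with `σ`, `N (F
x) - N (F 0)` differs from `N x` by at most 1. Dividing by `N 1 ≥ n + 1` makes the defect small. -/
lemma exists_almost_equivariant (hΓ : IsMinimalOnLine Γ)
    (hZ : translate (Multiplicative.ofAdd (1 : ℝ)) ∈ Γ)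
    (h : ∀ x y, x < y → ¬ Contractible Γ x y) (n : ℕ) :
    ∃ r : ℝ → ℝ, Monotone r ∧ r 1 = 1 ∧
      ∀ F ∈ Γ, ∀ x, |r (F x) - r (F 0) - r x| ≤ 1 / ((n : ℝ) + 1) := by
  obtain ⟨σ, δ, hδ, hcomm, hge, hle⟩ :=
    exists_small_centralizing hΓ hZ h (η := 1 / ((n : ℝ) + 1)) (by positivity)
  choose N hN1 hN2 using exists_orbit_count hδ hge
  have hmono := zpow_apply_strictMono hδ hge 0
  have hNmono : Monotone N := fun x y hxy =>
    Int.lt_add_one_iff.1 (hmono.lt_iff_lt.1 ((hN1 x).trans_lt (hxy.trans_lt (hN2 y))))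
  have hcommz : ∀ F ∈ Γ, ∀ m : ℤ, ∀ x, F ((σ ^ m : CircleDeg1Liftˣ) x) =
      (σ ^ m : CircleDeg1Liftˣ) (F x) := by
    intro F hF m x
    have hc : Commute F σ := units_ext fun x => (hcomm F hF x).symm
    rw [← units_mul_apply, (hc.zpow_right m).eq, units_mul_apply]
  have hquasi : ∀ F ∈ Γ, ∀ x, N x ≤ N (F x) - N (F 0) ∧ N (F x) - N (F 0) ≤ N x + 1 := by
    intro F hF x
    have h1 : (σ ^ (N x + N (F 0)) : CircleDeg1Liftˣ) 0 ≤ F x := by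
      rw [zpow_add, units_mul_apply]
      refine ((σ ^ N x : CircleDeg1Liftˣ) : CircleDeg1Lift).monotone (hN1 (F 0)) |>.trans ?_
      rw [← hcommz F hF]
      exact (F : CircleDeg1Lift).monotone (hN1 x)
    have h2 : F x < (σ ^ (N x + 1 + (N (F 0) + 1)) : CircleDeg1Liftˣ) 0 := by
      rw [zpow_add, units_mul_apply]
      refine lt_trans ?_ (units_strictMono (σ ^ (N x + 1)) (hN2 (F 0)))
      rw [← hcommz F hF]
      exact units_strictMono F (hN2 x)
    have h3 := hmono.lt_iff_lt.1 (h1.trans_lt (hN2 (F x)))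
    have h4 := hmono.lt_iff_lt.1 ((hN1 (F x)).trans_lt h2)
    constructor <;> omega
  have hN1n : ((n : ℝ) + 1) ≤ N 1 := by
    have hn : (σ ^ ((n : ℤ) + 1) : CircleDeg1Liftˣ) 0 ≤ 1 := by
      have := pow_apply_le_add_mul hle (n + 1) 0
      push_cast at this
      rw [zero_add, mul_one_div_cancel (by positivity)] at this
      exact_mod_cast this
    have := hmono.lt_iff_lt.1 (hn.trans_lt (hN2 1))
    have h' : (n : ℤ) + 1 ≤ N 1 := by omega
    exact_mod_cast h'
  have hpos : (0 : ℝ) < N 1 := lt_of_lt_of_le (by positivity) hN1n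
  refine ⟨fun x => N x / N 1, fun x y hxy => ?_, div_self hpos.ne', fun F hF x => ?_⟩
  · have : (N x : ℝ) ≤ N y := by exact_mod_cast hNmono hxy
    simp only
    gcongr
  · obtain ⟨h1, h2⟩ := hquasi F hF x
    have h1' : (N x : ℝ) ≤ N (F x) - N (F 0) := by exact_mod_cast h1
    have h2' : (N (F x) : ℝ) - N (F 0) ≤ N x + 1 := by exact_mod_cast h2
    rw [← sub_div, ← sub_div, abs_div, abs_of_pos hpos]
    exact div_le_div₀ zero_le_one (abs_le.2 ⟨by linarith, by linarith⟩) (by positivity) hN1n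

/-- A minimal group of lifts without contractible intervals is conjugate into the translations. -/
lemma exists_equivariant_of_not_contractible (hΓ : IsMinimalOnLine Γ)
    (hZ : translate (Multiplicative.ofAdd (1 : ℝ)) ∈ Γ)
    (h : ∀ x y, x < y → ¬ Contractible Γ x y) :
    ∃ R : CircleDeg1Lift, ∀ F ∈ Γ, ∃ c : ℝ, ∀ x, R (F x) = R x + c := by
  choose r hmono hr1 hquasi using exists_almost_equivariant hΓ hZ h
  have hle1 : ∀ n : ℕ, 1 / ((n : ℝ) + 1) ≤ 1 := fun n => by
    rw [div_le_one (by positivity)]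
    linarith [(Nat.cast_nonneg n : (0 : ℝ) ≤ n)]
  have hstep : ∀ n x, |r n (x + 1) - 1 - r n x| ≤ 1 / ((n : ℝ) + 1) := by
    intro n x
    have := hquasi n _ hZ x
    rwa [CircleDeg1Lift.translate_apply, CircleDeg1Lift.translate_apply, add_zero, hr1,
      add_comm] at this
  have h0 : ∀ n, |r n 0| ≤ 1 := by
    intro n
    have := (hquasi n 1 Γ.one_mem 0).trans (hle1 n)
    simpa using this
  -- Almost equivariance under the unit translation bounds each increment by 2, uniformly in `n`.
  have hbound : ∀ (j : ℕ) (n : ℕ), r n j ≤ 1 + 2 * j ∧ -(1 + 2 * j) ≤ r n (-j) := by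
    intro j n
    induction j with
    | zero => simpa using abs_le.1 (h0 n) |>.symm
    | succ j ih =>
      have h1 := abs_le.1 ((hstep n j).trans (hle1 n))
      have h2 := abs_le.1 ((hstep n (-(j : ℝ) - 1)).trans (hle1 n))
      rw [sub_add_cancel] at h2
      push_cast
      rw [show -((j : ℝ) + 1) = -j - 1 by ring]
      constructor <;> linarith [ih.1, ih.2, h1.1, h1.2, h2.1, h2.2]
  -- A limit along an ultrafilter handles all `x` at once and preserves monotonicity; the defect
  -- `1/(n+1)` disappears.
  have hlim : ∀ x, ∃ ℓ, Tendsto (fun n => r n x) (hyperfilter ℕ) (𝓝 ℓ) := by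
    intro x
    obtain ⟨j, hj⟩ := exists_nat_ge |x|
    obtain ⟨ℓ, -, hℓ⟩ := isCompact_Icc (a := -(1 + 2 * (j : ℝ))) (b := 1 + 2 * (j : ℝ))
      |>.ultrafilter_le_nhds ((hyperfilter ℕ).map fun n => r n x) (by
        rw [le_principal_iff]
        refine Filter.mem_map.2 (Filter.univ_mem' fun n => ?_)
        exact ⟨(hbound j n).2.trans (hmono n (by linarith [neg_abs_le x])),
          (hmono n ((le_abs_self x).trans hj)).trans (hbound j n).1⟩)
    exact ⟨ℓ, hℓ⟩
  choose R hR using hlim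
  have hsmall : Tendsto (fun n : ℕ => 1 / ((n : ℝ) + 1)) (hyperfilter ℕ) (𝓝 0) :=
    tendsto_one_div_add_atTop_nhds_zero_nat.mono_left Nat.hyperfilter_le_atTop
  have hR1 : R 1 = 1 := tendsto_nhds_unique (hR 1) (by simp only [hr1]; exact tendsto_const_nhds)
  have heq : ∀ F ∈ Γ, ∀ x, R (F x) = R x + R (F 0) := by
    intro F hF x
    have h1 := (((hR (F x)).sub (hR (F 0))).sub (hR x)).abs
    have h2 := le_of_tendsto_of_tendsto' h1 hsmall fun n => hquasi n F hF x
    have := abs_nonpos_iff.1 h2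
    linarith
  refine ⟨⟨⟨R, fun x y hxy => le_of_tendsto_of_tendsto' (hR x) (hR y) fun n => hmono n hxy⟩,
    fun x => ?_⟩, fun F hF => ⟨R (F 0), heq F hF⟩⟩
  have := heq _ hZ x
  rw [CircleDeg1Lift.translate_apply, CircleDeg1Lift.translate_apply, add_zero, hR1,
    add_comm] at this
  exact this

end Equicontinuous

/-! ### Invariant measures and vanishing of the cocycle -/

section Measures

lemma stieltjesFunction_map_eq_add {R : CircleDeg1Lift} {F : CircleDeg1Liftˣ} {c : ℝ}
    (h : ∀ x, R (F x) = R x + c) (x : ℝ) :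
    R.monotone.stieltjesFunction (F x) = R.monotone.stieltjesFunction x + c := by
  rw [R.monotone.stieltjesFunction_eq, R.monotone.stieltjesFunction_eq]
  have h1 : Tendsto (F : ℝ → ℝ) (𝓝[>] x) (𝓝[>] (F x)) :=
    tendsto_nhdsWithin_of_tendsto_nhds_of_eventually_within _
      ((units_continuous F).continuousAt.tendsto.mono_left nhdsWithin_le_nhds)
      (eventually_mem_nhdsWithin.mono fun y hy => units_strictMono F hy)
  have h2 := (R.monotone.tendsto_rightLim (F x)).comp h1
  have h3 := (R.monotone.tendsto_rightLim x).add_const c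
  refine tendsto_nhds_unique h2 (h3.congr fun y => ?_)
  exact (h y).symm

lemma measure_map_eq_of_map_eq_add {s : StieltjesFunction ℝ} {F : CircleDeg1Liftˣ} {c : ℝ}
    (h : ∀ x, s (F x) = s x + c) : s.measure.map F = s.measure := by
  symm
  refine Measure.ext_of_Ioc _ _ fun a b _ => ?_
  rw [Measure.map_apply (units_continuous F).measurable measurableSet_Ioc]
  have hpre : (F : ℝ → ℝ) ⁻¹' Ioc a b = Ioc (F⁻¹ a) (F⁻¹ b) := by
    ext y
    rw [mem_preimage, mem_Ioc, mem_Ioc, ← (units_strictMono F).lt_iff_lt (a := F⁻¹ a),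
      ← (units_strictMono F).le_iff_le (b := F⁻¹ b), units_apply_inv_apply, units_apply_inv_apply]
  have e := fun y => h (F⁻¹ y)
  simp only [units_apply_inv_apply] at e
  rw [hpre, StieltjesFunction.measure_Ioc, StieltjesFunction.measure_Ioc, e a, e b,
    add_sub_add_right_eq_sub]

variable {G : Type*} [Group G]

/-- The group of all lifts of the homeomorphisms `φ g`. -/
def liftGroup (φ : G →* HomeoPlus) : Subgroup CircleDeg1Liftˣ where
  carrier := {F | ∃ g, IsLift (F : CircleDeg1Lift) (φ g)}
  one_mem' := ⟨1, fun x => by rw [map_one]; rfl⟩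
  mul_mem' := by
    rintro F H ⟨g, hF⟩ ⟨h, hH⟩
    refine ⟨g * h, fun x => ?_⟩
    rw [map_mul, units_mul_apply, hF, hH]
    rfl
  inv_mem' := by
    rintro F ⟨g, hF⟩
    refine ⟨g⁻¹, fun x => ?_⟩
    have h1 := hF (F⁻¹ x)
    rw [units_apply_inv_apply] at h1
    rw [map_inv, h1]
    exact ((φ g : S1 ≃ₜ S1).symm_apply_apply _).symm

lemma translate_mem_liftGroup (φ : G →* HomeoPlus) (n : ℤ) :
    translate (Multiplicative.ofAdd (n : ℝ)) ∈ liftGroup φ := by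
  refine ⟨1, fun x => ?_⟩
  rw [CircleDeg1Lift.translate_apply, map_one, AddCircle.coe_add,
    (AddCircle.coe_eq_zero_iff (1 : ℝ)).2 ⟨n, by simp⟩, zero_add]
  rfl

lemma measurable_homeoPlus (f : HomeoPlus) : Measurable (f : S1 → S1) :=
  (f : S1 ≃ₜ S1).continuous.measurable

/-- The Stieltjes measure of `R` is invariant under every lift, including integer translations, so
its restriction to a fundamental domain descends to an invariant probability measure. -/
lemma isTypeZero_of_equivariant (φ : G →* HomeoPlus) (R : CircleDeg1Lift)
    (h : ∀ F ∈ liftGroup φ, ∃ c : ℝ, ∀ x, R (F x) = R x + c) : IsTypeZero φ := by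
  set s := R.monotone.stieltjesFunction with hs
  have hmap : ∀ F ∈ liftGroup φ, s.measure.map F = s.measure := by
    intro F hF
    obtain ⟨c, hc⟩ := h F hF
    exact measure_map_eq_of_map_eq_add (stieltjesFunction_map_eq_add hc)
  have hinv : VAddInvariantMeasure (AddSubgroup.zmultiples (1 : ℝ)) ℝ s.measure := by
    refine ⟨?_⟩
    rintro ⟨_, n, rfl⟩ A hA
    have h1 := hmap _ (translate_mem_liftGroup φ n)
    conv_rhs => rw [← h1, Measure.map_apply (units_continuous _).measurable hA]
    congr 1
    ext x
    simp [AddSubgroup.vadd_def]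
  have hone : s.measure (Ioc 0 1) = 1 := by
    rw [StieltjesFunction.measure_Ioc]
    have h1 := stieltjesFunction_map_eq_add (R := R)
      (F := translate (Multiplicative.ofAdd (1 : ℝ))) (c := 1)
      (fun x => by rw [CircleDeg1Lift.translate_apply, map_one_add, add_comm]) 0
    rw [CircleDeg1Lift.translate_apply, add_zero, ← hs] at h1
    rw [h1, add_sub_cancel_left, ENNReal.ofReal_one]
  have hcoe : Measurable ((↑) : ℝ → S1) := AddCircle.measurable_mk'
  have hprob : IsProbabilityMeasure (s.measure.restrict (Ioc 0 1)) :=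
    ⟨by rw [Measure.restrict_apply_univ, hone]⟩
  refine ⟨(s.measure.restrict (Ioc 0 1)).map ((↑) : ℝ → S1),
    Measure.isProbabilityMeasure_map hcoe.aemeasurable, fun g => ?_⟩
  ext A hA
  obtain ⟨F, hF⟩ := (φ g).2
  have hFΓ : F ∈ liftGroup φ := ⟨g, hF⟩
  have hB : MeasurableSet (((↑) : ℝ → S1) ⁻¹' A) := hcoe hA
  rw [Measure.map_apply (measurable_homeoPlus _) hA,
    Measure.map_apply hcoe (measurable_homeoPlus _ hA), Measure.map_apply hcoe hA,
    Measure.restrict_apply hB, Measure.restrict_apply (hcoe (measurable_homeoPlus _ hA))]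
  have hset : ((↑) : ℝ → S1) ⁻¹' ((φ g : S1 → S1) ⁻¹' A) ∩ Ioc 0 1 =
      (F : ℝ → ℝ) ⁻¹' (((↑) : ℝ → S1) ⁻¹' A ∩ Ioc (F 0) (F 0 + 1)) := by
    ext x
    have h1 : F 0 + 1 = F 1 := by rw [← map_add_one, zero_add]
    simp only [mem_inter_iff, mem_preimage, mem_Ioc, h1, (units_strictMono F).lt_iff_lt,
      (units_strictMono F).le_iff_le]
    rw [hF x]
  rw [hset, ← Measure.map_apply (units_continuous F).measurable (hB.inter measurableSet_Ioc),
    hmap F hFΓ]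
  -- `F` carries `(0, 1]` to `(F 0, F 0 + 1]`; both are fundamental domains for `ℤ`, so a periodic
  -- set has equal mass in each.
  have hdom := (isAddFundamentalDomain_Ioc one_pos (F 0) s.measure).measure_set_eq
    (isAddFundamentalDomain_Ioc one_pos 0 s.measure) hB (by
      rintro ⟨_, n, rfl⟩
      ext x
      have : (((n • (1 : ℝ) + x : ℝ)) : S1) = x := by
        rw [AddCircle.coe_add, (AddCircle.coe_eq_zero_iff (1 : ℝ)).2 ⟨n, rfl⟩, zero_add]
      simp only [mem_preimage, AddSubgroup.vadd_def, vadd_eq_add, this])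
  rw [zero_add] at hdom
  exact hdom

lemma isTypeZero_of_finite_invariant (φ : G →* HomeoPlus) {s : Set S1} (hfin : s.Finite)
    (hne : s.Nonempty) (hs : ∀ g, ∀ x ∈ s, φ g x ∈ s) : IsTypeZero φ := by
  refine ⟨ProbabilityTheory.uniformOn s, ProbabilityTheory.isProbabilityMeasure_uniformOn hfin hne,
    fun g => ?_⟩
  ext A hA
  rw [Measure.map_apply (measurable_homeoPlus _) hA, ProbabilityTheory.uniformOn,
    ProbabilityTheory.cond_apply hfin.measurableSet, ProbabilityTheory.cond_apply hfin.measurableSet]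
  congr 1
  rw [← Measure.count_injective_image (φ g : S1 ≃ₜ S1).injective]
  congr 1
  ext x
  constructor
  · rintro ⟨y, ⟨hy, hyA⟩, rfl⟩
    exact ⟨hs g y hy, hyA⟩
  · rintro ⟨hx, hxA⟩
    have e : φ g (φ g⁻¹ x) = x := by
      rw [map_inv]
      exact (φ g : S1 ≃ₜ S1).apply_symm_apply x
    refine ⟨φ g⁻¹ x, ⟨hs _ _ hx, ?_⟩, e⟩
    rw [mem_preimage, e]
    exact hxA

lemma isTypeZero_of_hasGlobalFixedPoint (φ : G →* HomeoPlus) (h : HasGlobalFixedPoint φ) :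
    IsTypeZero φ := by
  obtain ⟨x, hx⟩ := h
  refine isTypeZero_of_finite_invariant φ (finite_singleton x) (singleton_nonempty x) ?_
  rintro g _ rfl
  exact hx g

/-- The displacement `t ↦ F t - t` of a lift, as a function on the circle. -/
def displacement (F : CircleDeg1Liftˣ) : S1 → ℝ :=
  Function.Periodic.lift (f := fun t => F t - t) (c := (1 : ℝ)) fun t => by simp

lemma displacement_coe (F : CircleDeg1Liftˣ) (t : ℝ) : displacement F (t : S1) = F t - t :=
  rfl

lemma continuous_displacement (F : CircleDeg1Liftˣ) : Continuous (displacement F) :=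
  continuous_coinduced_dom.2 ((units_continuous F).sub continuous_id)

lemma integrable_displacement (μ : Measure S1) [IsProbabilityMeasure μ] (F : CircleDeg1Liftˣ) :
    Integrable (displacement F) μ :=
  (continuous_displacement F).integrable_of_hasCompactSupport
    (HasCompactSupport.of_compactSpace _)

lemma integral_displacement_mul {μ : Measure S1} [IsProbabilityMeasure μ] {F H : CircleDeg1Liftˣ}
    {h : HomeoPlus} (hH : IsLift (H : CircleDeg1Lift) h) (hμ : μ.map h = μ) :
    ∫ x, displacement (F * H) x ∂μ = ∫ x, displacement F x ∂μ + ∫ x, displacement H x ∂μ := by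
  have h1 : ∀ x, displacement (F * H) x = displacement F (h x) + displacement H x := by
    intro x
    induction x using QuotientAddGroup.induction_on with
    | H t =>
      have := hH t
      rw [← this]
      erw [displacement_coe, displacement_coe, displacement_coe, units_mul_apply]
      ring
  have h2 : ∫ x, displacement F (h x) ∂μ = ∫ x, displacement F x ∂μ := by
    conv_rhs => rw [← hμ]
    exact (integral_map (measurable_homeoPlus h).aemeasurable
      (continuous_displacement F).aestronglyMeasurable).symm
  have h3 : Integrable (fun x => displacement F (h x)) μ :=
    ((continuous_displacement F).comp (h : S1 ≃ₜ S1).continuous).integrable_of_hasCompactSupport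
      (HasCompactSupport.of_compactSpace _)
  simp only [h1]
  rw [integral_add h3 (integrable_displacement μ H), h2]

/-- Both sides are multiplied by `n` when `F` is replaced by `F ^ n`, and they never differ by more
than 1. -/
lemma integral_displacement_eq {φ : G →* HomeoPlus} {μ : Measure S1} [IsProbabilityMeasure μ]
    (hμ : ∀ g, μ.map (φ g) = μ) {F : CircleDeg1Liftˣ} (hF : F ∈ liftGroup φ) :
    ∫ x, displacement F x ∂μ = (F : CircleDeg1Lift).translationNumber := by
  have hbound : ∀ E : CircleDeg1Liftˣ,
      |∫ x, displacement E x ∂μ - (E : CircleDeg1Lift).translationNumber| ≤ 1 := by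
    intro E
    have h1 : ∀ x, |displacement E x - (E : CircleDeg1Lift).translationNumber| ≤ 1 := by
      intro x
      induction x using QuotientAddGroup.induction_on with
      | H t =>
        erw [displacement_coe]
        have h1 := map_lt_add_translationNumber_add_one (E : CircleDeg1Lift) t
        have h2 := translationNumber_le_map_sub_add_one (E : CircleDeg1Lift) t
        rw [abs_le]
        constructor <;> linarith
    have h2 : ∫ x, (displacement E x - (E : CircleDeg1Lift).translationNumber) ∂μ =
        ∫ x, displacement E x ∂μ - (E : CircleDeg1Lift).translationNumber := by
      rw [integral_sub (integrable_displacement μ E) (integrable_const _)]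
      simp
    rw [← h2]
    have := norm_integral_le_of_norm_le_const (μ := μ) (C := 1)
      (Eventually.of_forall fun x => (Real.norm_eq_abs _).trans_le (h1 x))
    simpa using this
  have hpow : ∀ n : ℕ, ∫ x, displacement (F ^ n) x ∂μ = n * ∫ x, displacement F x ∂μ := by
    intro n
    induction n with
    | zero =>
      have : displacement 1 = 0 := by
        ext x
        induction x using QuotientAddGroup.induction_on with
        | H t =>
          erw [displacement_coe]
          simp
      simp [this]
    | succ n ih =>
      obtain ⟨g, hg⟩ := hF
      rw [pow_succ, integral_displacement_mul hg (hμ g), ih]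
      push_cast
      ring
  by_contra hne
  have hpos : 0 < |∫ x, displacement F x ∂μ - (F : CircleDeg1Lift).translationNumber| :=
    abs_pos.2 (sub_ne_zero.2 hne)
  obtain ⟨n, hn⟩ := exists_nat_gt
    (1 / |∫ x, displacement F x ∂μ - (F : CircleDeg1Lift).translationNumber|)
  have := hbound (F ^ n)
  rw [hpow, Units.val_pow_eq_pow_val, translationNumber_pow, ← mul_sub, abs_mul, Nat.abs_cast] at this
  rw [div_lt_iff₀ hpos] at hn
  linarith

lemma IsTypeZero.pullbackEulerCocycle_eq_zero {φ : G →* HomeoPlus} (h : IsTypeZero φ) (g₁ g₂ : G) :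
    pullbackEulerCocycle φ g₁ g₂ = 0 := by
  obtain ⟨μ, hμ1, hμ⟩ := h
  have m1 : someLift (φ g₁) ∈ liftGroup φ := ⟨g₁, isLift_someLift _⟩
  have m2 : someLift (φ g₂) ∈ liftGroup φ := ⟨g₂, isLift_someLift _⟩
  unfold pullbackEulerCocycle eulerCocycle
  rw [← integral_displacement_eq hμ (mul_mem m1 m2), ← integral_displacement_eq hμ m1,
    ← integral_displacement_eq hμ m2, integral_displacement_mul (isLift_someLift _) (hμ g₂)]
  ring

end Measures

/-! ### Factor actions -/

section Descent

lemma exists_homeoPlus_isLift (F : CircleDeg1Liftˣ) :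
    ∃ f : HomeoPlus, IsLift (F : CircleDeg1Lift) f := by
  have hper : ∀ E : CircleDeg1Liftˣ, Function.Periodic (fun t => ((E t : ℝ) : S1)) (1 : ℝ) := by
    intro E t
    simp only [map_add_one, AddCircle.coe_add, AddCircle.coe_period, add_zero]
  have hcont : ∀ E : CircleDeg1Liftˣ, Continuous (hper E).lift := fun E =>
    continuous_coinduced_dom.2 ((AddCircle.continuous_mk' 1).comp (units_continuous E))
  have hcomp : ∀ E E' : CircleDeg1Liftˣ, E * E' = 1 → ∀ x, (hper E).lift ((hper E').lift x) = x := by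
    intro E E' h x
    induction x using QuotientAddGroup.induction_on with
    | H t =>
      change ((E (E' t) : ℝ) : S1) = t
      rw [← units_mul_apply, h]
      rfl
  let f : S1 ≃ₜ S1 :=
    { toFun := (hper F).lift
      invFun := (hper F⁻¹).lift
      left_inv := hcomp _ _ (inv_mul_cancel F)
      right_inv := hcomp _ _ (mul_inv_cancel F)
      continuous_toFun := hcont F
      continuous_invFun := hcont F⁻¹ }
  exact ⟨⟨f, F, fun _ => rfl⟩, fun _ => rfl⟩

variable {G : Type*} [Group G]

/-- An action descends along a monotone surjection of the line compatible with it. -/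
theorem exists_factor (φ : G →* HomeoPlus) {H : ℝ → ℝ} (hmono : Monotone H)
    (hsurj : Function.Surjective H) {h : S1 → S1} (hh : ∀ x : ℝ, ((H x : ℝ) : S1) = h (x : S1))
    (h0 : ∀ F ∈ liftGroup φ, ∀ x y, H x = H y → H (F x) = H (F y))
    (h1 : ∀ F ∈ liftGroup φ, ∀ x y, H x = H y + 1 → H (F x) = H (F y) + 1) :
    ∃ φ' : G →* HomeoPlus, (∀ g x, φ' g (h x) = h (φ g x)) ∧
      (∀ F ∈ liftGroup φ, ∃ F' ∈ liftGroup φ', ∀ x, F' (H x) = H (F x)) ∧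
      ∀ F' ∈ liftGroup φ', ∃ F ∈ liftGroup φ, ∃ n : ℤ, ∀ x, F' (H x) = H (F x) + n := by
  -- The factor lift is `H ∘ F ∘ S` for an arbitrary section `S`; `h0` makes it independent of `S`,
  -- and `h1` gives degree one. `H` itself need not have degree one, so that `x ↦ k x` is allowed.
  choose S hS using hsurj
  have hlift : ∀ F ∈ liftGroup φ, ∃ F' : CircleDeg1Lift, ∀ x, F' (H x) = H (F x) := by
    intro F hF
    refine ⟨⟨⟨fun y => H (F (S y)), fun y y' hy => ?_⟩, fun y => ?_⟩, fun x => ?_⟩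
    · rcases le_total (S y) (S y') with h' | h'
      · exact hmono ((F : CircleDeg1Lift).monotone h')
      · have h2 := hmono h'
        rw [hS, hS] at h2
        rw [le_antisymm hy h2]
    · exact h1 F hF _ _ (by rw [hS, hS])
    · exact h0 F hF _ _ (hS _)
  have hunit : ∀ F ∈ liftGroup φ, ∃ F' : CircleDeg1Liftˣ, ∀ x, F' (H x) = H (F x) := by
    intro F hF
    obtain ⟨E, hE⟩ := hlift F hF
    obtain ⟨E', hE'⟩ := hlift F⁻¹ (inv_mem hF)
    refine ⟨⟨E, E', ?_, ?_⟩, hE⟩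
    · ext y
      rw [mul_apply, ← hS y, hE', hE, units_apply_inv_apply]
      rfl
    · ext y
      rw [mul_apply, ← hS y, hE, hE', units_inv_apply_apply]
      rfl
  have hmem : ∀ g, someLift (φ g) ∈ liftGroup φ := fun g => ⟨g, isLift_someLift _⟩
  choose E hE using fun g => hunit _ (hmem g)
  choose f hf using fun g => exists_homeoPlus_isLift (E g)
  have hsemi : ∀ g x, f g (h x) = h (φ g x) := by
    intro g x
    induction x using QuotientAddGroup.induction_on with
    | H t =>
      have e1 := hf g (H t)
      rw [hE, hh, hh, isLift_someLift (φ g) t] at e1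
      exact e1.symm
  have hhs : Function.Surjective h := by
    intro y
    induction y using QuotientAddGroup.induction_on with
    | H t =>
      refine ⟨(S t : ℝ), ?_⟩
      rw [← hh, hS]
  let φ' : G →* HomeoPlus := MonoidHom.mk' f fun a b => by
    refine Subtype.ext (Homeomorph.ext fun y => ?_)
    obtain ⟨x, rfl⟩ := hhs y
    change f (a * b) (h x) = f a (f b (h x))
    rw [hsemi, hsemi, hsemi, map_mul]
    rfl
  have hlift' : ∀ g, ∀ F F' : CircleDeg1Liftˣ, IsLift (F : CircleDeg1Lift) (φ g) →
      (∀ x, F' (H x) = H (F x)) → IsLift (F' : CircleDeg1Lift) (φ' g) := by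
    intro g F F' hF hF' y
    rw [← hS y, hF', hh, hh, hF]
    exact (hsemi g _).symm
  refine ⟨φ', hsemi, ?_, ?_⟩
  · rintro F ⟨g, hF⟩
    obtain ⟨F', hF'⟩ := hunit F ⟨g, hF⟩
    exact ⟨F', ⟨g, hlift' g F F' hF hF'⟩, hF'⟩
  · rintro F' ⟨g, hF'⟩
    obtain ⟨n, hn⟩ := exists_int_of_isLift (hlift' g _ _ (isLift_someLift (φ g)) (hE g)) hF'
    refine ⟨_, hmem g, n, fun x => ?_⟩
    rw [hn, units_mul_apply, hE, CircleDeg1Lift.translate_apply, add_comm]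

end Descent

/-! ### Behaviour of the cocycle under semiconjugacy and fold lifts -/

section Invariance

variable {G : Type*} [Group G]

/-- `E ∘ H` and `H ∘ F` differ by an integer `n x`, which might jump because `H` need not be
continuous. A jump makes `h` constant, and its value is then a global fixed point of `φ₂`. -/
lemma exists_isLift_semiconj {φ₁ φ₂ : G →* HomeoPlus} (hfix : ¬ HasGlobalFixedPoint φ₂)
    {h : S1 → S1} {H : CircleDeg1Lift} (hH : IsLift H h) (hsemi : ∀ g x, φ₂ g (h x) = h (φ₁ g x))
    {g : G} {F : CircleDeg1Liftˣ} (hF : IsLift (F : CircleDeg1Lift) (φ₁ g)) :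
    ∃ E : CircleDeg1Liftˣ, IsLift (E : CircleDeg1Lift) (φ₂ g) ∧ ∀ x, E (H x) = H (F x) := by
  obtain ⟨E, hE⟩ := (φ₂ g).2
  have hex : ∀ x, ∃ n : ℤ, E (H x) = H (F x) + n := by
    intro x
    have e : ((E (H x) - H (F x) : ℝ) : S1) = 0 := by
      rw [AddCircle.coe_sub, hE, hH, hH, hF]
      exact sub_eq_zero.2 (hsemi g x)
    obtain ⟨n, hn⟩ := (AddCircle.coe_eq_zero_iff (1 : ℝ)).1 e
    simp only [zsmul_eq_mul, mul_one] at hn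
    exact ⟨n, by linarith⟩
  choose n hn using hex
  have hper : ∀ x, n (Int.fract x) = n x := by
    intro x
    have e := hn (Int.fract x)
    rw [← Int.self_sub_floor, map_sub_int, map_sub_int, map_sub_int, map_sub_int, hn x] at e
    have e2 : (n (x - ⌊x⌋) : ℝ) = n x := by linarith
    rw [← Int.self_sub_floor]
    exact_mod_cast e2
  have hconst : ∀ y, 0 ≤ y → y < 1 → n y = n 0 := by
    intro y hy0 hy1
    by_contra hne
    apply hfix
    have key : ∀ z : ℝ, 0 ≤ z → z < 1 → h (z : S1) = h ((0 : ℝ) : S1) := by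
      have inj : ∀ z w : ℝ, h (φ₁ g (z : S1)) = h (φ₁ g (w : S1)) → h (z : S1) = h (w : S1) := by
        intro z w e
        rw [← hsemi, ← hsemi] at e
        exact (φ₂ g : S1 ≃ₜ S1).injective e
      have hE1 : E (H 1) = E (H 0) + 1 := by
        rw [← map_add_one, ← map_add_one, zero_add]
      have hH1 : H 1 = H 0 + 1 := by rw [← map_add_one, zero_add]
      have hF1 : H (F 1) = H (F 0) + 1 := by rw [← map_add_one, ← map_add_one, zero_add]
      have hcoe : ((1 : ℝ) : S1) = 0 := AddCircle.coe_period 1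
      have mE : Monotone fun x => E (H x) := (E : CircleDeg1Lift).monotone.comp H.monotone
      have mF : Monotone fun x => H (F x) := H.monotone.comp (F : CircleDeg1Lift).monotone
      have a0 := mE hy0
      have a1 := mE hy1.le
      have b0 := mF hy0
      have b1 := mF hy1.le
      simp only at a0 a1 b0 b1
      have e0 := hn 0
      have ey := hn y
      -- Both maps increase by exactly 1 over `[0, 1]`, so a jump at `y` leaves one of them constant
      -- on `[0, y]` and the other on `[y, 1]`. Injectivity of `φ₂ g` transfers constancy of `h ∘ φ₁
      -- g` to `h`.
      rcases lt_or_gt_of_ne hne with hlt | hlt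
      · have hlt' : (n y : ℝ) + 1 ≤ n 0 := by exact_mod_cast hlt
        have hEy : H y = H 0 := (units_strictMono E).injective (by linarith)
        have hFy : H (F y) = H (F 1) := by linarith
        intro z hz0 hz1
        rcases le_total z y with hzy | hzy
        · rw [← hH, ← hH, le_antisymm ((H.monotone hzy).trans hEy.le) (H.monotone hz0)]
        · have e : H (F z) = H (F 1) :=
            le_antisymm (mF hz1.le) (hFy.ge.trans (mF hzy))
          have := inj z 1 (by rw [← hF, ← hF, ← hH, ← hH, e])
          rw [this, hcoe]
          rfl
      · have hlt' : (n 0 : ℝ) + 1 ≤ n y := by exact_mod_cast hlt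
        have hEy : H y = H 1 := (units_strictMono E).injective (by linarith)
        have hFy : H (F y) = H (F 0) := by linarith
        intro z hz0 hz1
        rcases le_total z y with hzy | hzy
        · have e : H (F z) = H (F 0) :=
            le_antisymm ((mF hzy).trans hFy.le) (mF hz0)
          exact inj z 0 (by rw [← hF, ← hF, ← hH, ← hH, e])
        · have e : H z = H 1 := le_antisymm (H.monotone hz1.le) (hEy.ge.trans (H.monotone hzy))
          rw [← hH, e, hH, hcoe]
          rfl
    refine ⟨h ((0 : ℝ) : S1), fun g' => ?_⟩
    rw [hsemi]
    obtain ⟨z, hz, hzeq⟩ := AddCircle.eq_coe_Ico (φ₁ g' ((0 : ℝ) : S1))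
    rw [← hzeq]
    exact key z hz.1 hz.2
  have hall : ∀ x, n x = n 0 := fun x => by
    rw [← hper]
    exact hconst _ (Int.fract_nonneg _) (Int.fract_lt_one _)
  refine ⟨translate (Multiplicative.ofAdd ((-n 0 : ℤ) : ℝ)) * E, fun x => ?_, fun x => ?_⟩
  · rw [units_mul_apply, CircleDeg1Lift.translate_apply, AddCircle.coe_add,
      (AddCircle.coe_eq_zero_iff (1 : ℝ)).2 ⟨-n 0, by simp⟩, zero_add, hE]
  · rw [units_mul_apply, CircleDeg1Lift.translate_apply, hn, hall x]
    push_cast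
    ring

theorem pullbackEulerCocycle_eq_of_semiconj {φ₁ φ₂ : G →* HomeoPlus}
    (hfix : ¬ HasGlobalFixedPoint φ₂) {h : S1 → S1} (hh : IsDegreeOneMonotone h)
    (hsemi : ∀ g x, φ₂ g (h x) = h (φ₁ g x)) :
    pullbackEulerCocycle φ₁ = pullbackEulerCocycle φ₂ := by
  obtain ⟨H, hH⟩ := hh
  ext a b
  obtain ⟨E, hE, hEH⟩ := exists_isLift_semiconj hfix hH hsemi (isLift_someLift (φ₁ a))
  obtain ⟨E', hE', hEH'⟩ := exists_isLift_semiconj hfix hH hsemi (isLift_someLift (φ₁ b))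
  unfold pullbackEulerCocycle
  rw [eulerCocycle_eq hE hE', eulerCocycle]
  have e1 := translationNumber_eq_of_semiconj (f := H) (g₁ := someLift (φ₁ a)) (g₂ := E)
    fun x => (hEH x).symm
  have e2 := translationNumber_eq_of_semiconj (f := H) (g₁ := someLift (φ₁ b)) (g₂ := E')
    fun x => (hEH' x).symm
  have e3 := translationNumber_eq_of_semiconj (f := H)
    (g₁ := (someLift (φ₁ a) * someLift (φ₁ b) : CircleDeg1Liftˣ))
    (g₂ := (E * E' : CircleDeg1Liftˣ)) fun x => by
      rw [units_mul_apply, units_mul_apply, hEH', hEH]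
  rw [e1, e2, e3]

lemma translationNumber_eq_mul_of_scale {F E : CircleDeg1Lift} {m : ℝ}
    (h : ∀ x, E (m * x) = m * F x) : E.translationNumber = m * F.translationNumber := by
  have hiter : ∀ n : ℕ, (E ^ n) 0 = m * (F ^ n) 0 := by
    intro n
    induction n with
    | zero => simp
    | succ n ih => rw [pow_succ', pow_succ', mul_apply, mul_apply, ih, h]
  have h1 := (tendsto_translationNumber F 0).const_mul m
  refine tendsto_nhds_unique (tendsto_translationNumber E 0) (h1.congr fun n => ?_)
  rw [hiter]
  ring

/-- Here both maps are continuous, so their integer difference is constant and can be absorbed into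
the lift. -/
lemma exists_isLift_scale {m : ℕ} {ψ χ : G →* HomeoPlus} (hψ : IsFoldLift m ψ χ) {g : G}
    {F : CircleDeg1Liftˣ} (hF : IsLift (F : CircleDeg1Lift) (ψ g)) :
    ∃ E : CircleDeg1Liftˣ, IsLift (E : CircleDeg1Lift) (χ g) ∧ ∀ x, E (m * x) = m * F x := by
  obtain ⟨E, hE⟩ := (χ g).2
  have hcoe : ∀ x : ℝ, ((m * x : ℝ) : S1) = m • (x : S1) := by
    intro x
    rw [← nsmul_eq_mul]
    rfl
  have hex : ∀ x : ℝ, ∃ n : ℤ, (n : ℝ) = E (m * x) - m * F x := by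
    intro x
    have e : ((E (m * x) - m * F x : ℝ) : S1) = 0 := by
      rw [AddCircle.coe_sub, hE, hcoe, hcoe, hF]
      exact sub_eq_zero.2 (hψ g x)
    obtain ⟨n, hn⟩ := (AddCircle.coe_eq_zero_iff (1 : ℝ)).1 e
    exact ⟨n, by simpa using hn⟩
  choose n hn using hex
  have hcont : Continuous n := by
    rw [Int.isClosedEmbedding_coe_real.isEmbedding.continuous_iff]
    have : ((↑) : ℤ → ℝ) ∘ n = fun x => E (m * x) - m * F x := funext hn
    rw [this]
    exact ((units_continuous E).comp (continuous_const.mul continuous_id)).sub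
      (continuous_const.mul (units_continuous F))
  have hconst : ∀ x, n x = n 0 := fun x => PreconnectedSpace.constant inferInstance hcont
  refine ⟨translate (Multiplicative.ofAdd ((-n 0 : ℤ) : ℝ)) * E, fun x => ?_, fun x => ?_⟩
  · rw [units_mul_apply, CircleDeg1Lift.translate_apply, AddCircle.coe_add,
      (AddCircle.coe_eq_zero_iff (1 : ℝ)).2 ⟨-n 0, by simp⟩, zero_add, hE]
  · have := hn x
    rw [hconst] at this
    rw [units_mul_apply, CircleDeg1Lift.translate_apply]
    push_cast
    linarith

theorem IsFoldLift.mul_pullbackEulerCocycle {m : ℕ} {ψ χ : G →* HomeoPlus} (hψ : IsFoldLift m ψ χ)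
    (a b : G) : m * pullbackEulerCocycle ψ a b = pullbackEulerCocycle χ a b := by
  obtain ⟨E, hE, hEF⟩ := exists_isLift_scale hψ (isLift_someLift (ψ a))
  obtain ⟨E', hE', hEF'⟩ := exists_isLift_scale hψ (isLift_someLift (ψ b))
  unfold pullbackEulerCocycle
  rw [eulerCocycle_eq hE hE', eulerCocycle, translationNumber_eq_mul_of_scale hEF,
    translationNumber_eq_mul_of_scale hEF', translationNumber_eq_mul_of_scale (m := m)
      (F := (someLift (ψ a) * someLift (ψ b) : CircleDeg1Liftˣ)) (E := (E * E' : CircleDeg1Liftˣ))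
      fun x => by rw [units_mul_apply, units_mul_apply, hEF', hEF]]
  ring

end Invariance

/-! ### Nonatomic measures and collapsing gaps -/

section NonatomicMeasure

lemma exists_noAtoms_of_not_countable {A : Set ℝ} (hA : MeasurableSet A) (h : ¬ A.Countable) :
    ∃ ν : Measure ℝ, IsProbabilityMeasure ν ∧ NullSingletonClass ν ∧ ν Aᶜ = 0 := by
  have : StandardBorelSpace A := hA.standardBorel
  have hI : ¬ Countable (Icc (0 : ℝ) 1) := by
    rw [Set.countable_coe_iff]
    exact (Cardinal.Real.Icc_countable_iff.not).2 (by norm_num)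
  have e : Icc (0 : ℝ) 1 ≃ᵐ A :=
    PolishSpace.measurableEquivOfNotCountable hI (by rwa [Set.countable_coe_iff])
  have hm : Measurable fun x => (e x : ℝ) := measurable_subtype_coe.comp e.measurable
  refine ⟨(volume : Measure (Icc (0 : ℝ) 1)).map fun x => (e x : ℝ),
    Measure.isProbabilityMeasure_map hm.aemeasurable, ⟨fun x => ?_⟩, ?_⟩
  · rw [Measure.map_apply hm (measurableSet_singleton x)]
    refine Set.Subsingleton.measure_zero (fun y hy z hz => ?_) _
    exact e.injective (Subtype.ext (hy.trans hz.symm))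
  · rw [Measure.map_apply hm hA.compl]
    have hempty : (fun x => (e x : ℝ)) ⁻¹' Aᶜ = ∅ := by
      ext x
      simp
    rw [hempty, measure_empty]

lemma not_countable_inter_Ioo {C : Set ℝ} (hC : IsClosed C) (hp : Preperfect C) {a b : ℝ}
    (h : (C ∩ Ioo a b).Nonempty) : ¬ (C ∩ Ioo a b).Countable := by
  obtain ⟨x, hx, hax, hxb⟩ := h
  obtain ⟨a', ha, ha'⟩ := exists_between hax
  obtain ⟨b', hb, hb'⟩ := exists_between hxb
  have hperf := (hp.open_inter (isOpen_Ioo (a := a') (b := b'))).perfect_closure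
  obtain ⟨f, hf, -, hinj⟩ := hperf.exists_nat_bool_injection
    (Set.Nonempty.closure ⟨x, ⟨ha', hb⟩, hx⟩)
  have hsub : closure (Ioo a' b' ∩ C) ⊆ C ∩ Ioo a b := by
    refine fun y hy => ⟨?_, ?_⟩
    · rw [← hC.closure_eq]
      exact closure_mono inter_subset_right hy
    · have := closure_mono (inter_subset_left.trans Ioo_subset_Icc_self) hy
      rw [isClosed_Icc.closure_eq] at this
      exact ⟨ha.trans_le this.1, this.2.trans_lt hb'⟩
  intro hcount
  have h1 := hcount.mono (hf.trans hsub)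
  rw [← image_univ] at h1
  have h2 := countable_of_injective_of_countable_image hinj.injOn h1
  rw [countable_univ_iff, ← Cardinal.mk_le_aleph0_iff] at h2
  simp only [Cardinal.mk_pi, Cardinal.prod_const, Cardinal.mk_fintype, Fintype.card_bool,
    Cardinal.lift_id, Cardinal.mk_nat] at h2
  exact (Cardinal.cantor Cardinal.aleph0).not_ge (by exact_mod_cast h2)

/-- Each rational interval meeting `C` meets it in an uncountable Borel set, which carries a
nonatomic probability measure. Sum these with weights `2^-(n+1)`. -/
lemma exists_noAtoms_of_preperfect {C : Set ℝ} (hC : IsClosed C) (hp : Preperfect C)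
    (hne : C.Nonempty) : ∃ ν : Measure ℝ, IsProbabilityMeasure ν ∧ NullSingletonClass ν ∧ ν Cᶜ = 0 ∧
      ∀ a b, (C ∩ Ioo a b).Nonempty → 0 < ν (Ioo a b) := by
  let I := {p : ℚ × ℚ // (C ∩ Ioo (p.1 : ℝ) p.2).Nonempty}
  have hrat : ∀ a b : ℝ, (C ∩ Ioo a b).Nonempty → ∃ i : I, Ioo (i.1.1 : ℝ) i.1.2 ⊆ Ioo a b := by
    rintro a b ⟨x, hx, hax, hxb⟩
    obtain ⟨r, har, hrx⟩ := exists_rat_btwn hax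
    obtain ⟨s, hxs, hsb⟩ := exists_rat_btwn hxb
    exact ⟨⟨(r, s), x, hx, hrx, hxs⟩, Ioo_subset_Ioo har.le hsb.le⟩
  have hI : Nonempty I := by
    obtain ⟨x, hx⟩ := hne
    obtain ⟨i, -⟩ := hrat (x - 1) (x + 1) ⟨x, hx, by linarith, by linarith⟩
    exact ⟨i⟩
  obtain ⟨e, he⟩ := exists_surjective_nat I
  choose ν hν hνa hν0 using fun n : ℕ => exists_noAtoms_of_not_countable
    (hC.measurableSet.inter measurableSet_Ioo) (not_countable_inter_Ioo hC hp (e n).2)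
  refine ⟨Measure.sum fun n => (2⁻¹ : ENNReal) ^ (n + 1) • ν n, ⟨?_⟩, ⟨fun x => ?_⟩, ?_, ?_⟩
  · rw [Measure.sum_apply _ MeasurableSet.univ]
    simp only [Measure.smul_apply, measure_univ, smul_eq_mul, mul_one]
    rw [ENNReal.tsum_geometric_add_one, ENNReal.one_sub_inv_two, inv_inv]
    exact ENNReal.inv_mul_cancel (by norm_num) (by norm_num)
  · rw [Measure.sum_apply _ (measurableSet_singleton x)]
    simp [fun n => (hνa n).measure_singleton x]
  · rw [Measure.sum_apply _ hC.measurableSet.compl]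
    simp only [Measure.smul_apply, smul_eq_mul, ENNReal.tsum_eq_zero, mul_eq_zero]
    exact fun n => Or.inr (measure_mono_null (compl_subset_compl.2 inter_subset_left) (hν0 n))
  · intro a b hab
    obtain ⟨i, hi⟩ := hrat a b hab
    obtain ⟨n, rfl⟩ := he i
    have hn : ν n (Ioo a b) = 1 := by
      refine (prob_compl_eq_zero_iff measurableSet_Ioo).1 (measure_mono_null ?_ (hν0 n))
      exact compl_subset_compl.2 (inter_subset_right.trans hi)
    rw [Measure.sum_apply _ measurableSet_Ioo]
    refine lt_of_lt_of_le ?_ (ENNReal.le_tsum n)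
    rw [Measure.smul_apply, hn, smul_eq_mul, mul_one]
    exact ENNReal.pow_pos (by norm_num) _

/-- A closed `ℤ`-periodic perfect set is the set of points of increase of a continuous monotone
degree one map. -/
lemma exists_collapse {C : Set ℝ} (hC : IsClosed C) (hp : Preperfect C) (hne : C.Nonempty)
    (hZ : ∀ x ∈ C, ∀ n : ℤ, x + n ∈ C) :
    ∃ H : CircleDeg1Lift, Continuous H ∧ ∀ x y, x ≤ y → (H x = H y ↔ ¬ (C ∩ Ioo x y).Nonempty) := by
  obtain ⟨ν, hν, hνa, hν0, hνpos⟩ := exists_noAtoms_of_preperfect hC hp hne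
  -- For `x ≥ 0` this counts the translates `t + n` in `(0, x]`, so its integral is the distribution
  -- function of the periodized measure.
  let d : ℝ → ℝ → ℝ := fun x t => (⌊x - t⌋ : ℝ) - ⌊-t⌋
  have hdmeas : ∀ x, Measurable (d x) := fun x => by
    refine Measurable.sub ?_ ?_
    · exact measurable_from_top.comp (Int.measurable_floor.comp (measurable_const.sub measurable_id))
    · exact measurable_from_top.comp (Int.measurable_floor.comp measurable_neg)
  have hdbound : ∀ x t, ‖d x t‖ ≤ |x| + 1 := by
    intro x t
    rw [Real.norm_eq_abs, abs_le]
    have h1 := Int.floor_le (x - t)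
    have h2 := Int.lt_floor_add_one (x - t)
    have h3 := Int.floor_le (-t)
    have h4 := Int.lt_floor_add_one (-t)
    have h5 := neg_abs_le x
    have h6 := le_abs_self x
    constructor <;> linarith
  have hdint : ∀ x, Integrable (d x) ν := fun x =>
    Integrable.of_bound (hdmeas x).aestronglyMeasurable _ (Eventually.of_forall (hdbound x))
  have hdmono : ∀ x y, x ≤ y → ∀ t, d x t ≤ d y t := by
    intro x y hxy t
    have : (⌊x - t⌋ : ℝ) ≤ ⌊y - t⌋ := by exact_mod_cast Int.floor_le_floor (by linarith)
    simp only [d]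
    linarith
  -- `d · t` jumps at `x` only if `x ∈ t + ℤ`, a null set of `t` since there are no atoms.
  have hnull : ∀ x : ℝ, ∀ᵐ t ∂ν, ∀ n : ℤ, t + n ≠ x := by
    intro x
    rw [ae_all_iff]
    intro n
    have : ν {x - n} = 0 := measure_singleton _
    filter_upwards [compl_mem_ae_iff.2 this] with t ht h
    exact ht (by rw [mem_singleton_iff]; linarith)
  let H : CircleDeg1Lift :=
    { toFun := fun x => ∫ t, d x t ∂ν
      monotone' := fun x y hxy => integral_mono (hdint x) (hdint y) (hdmono x y hxy)
      map_add_one' := fun x => by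
        have : ∀ t, d (x + 1) t = d x t + 1 := by
          intro t
          simp only [d]
          rw [show x + 1 - t = x - t + 1 by ring, Int.floor_add_one]
          push_cast
          ring
        simp only [this]
        rw [integral_add (hdint x) (integrable_const _)]
        simp }
  have hH : ∀ x, H x = ∫ t, d x t ∂ν := fun x => rfl
  refine ⟨H, ?_, ?_⟩
  · rw [continuous_iff_continuousAt]
    intro x
    refine continuousAt_of_dominated (F := d) (bound := fun _ => |x| + 1 + 1)
      (Eventually.of_forall fun y => (hdmeas y).aestronglyMeasurable) ?_ (integrable_const _) ?_
    · filter_upwards [Metric.ball_mem_nhds x one_pos] with y hy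
      refine Eventually.of_forall fun t => (hdbound y t).trans ?_
      rw [Metric.mem_ball, Real.dist_eq] at hy
      have := abs_sub_abs_le_abs_sub y x
      linarith
    · filter_upwards [hnull x] with t ht
      have h1 : (⌊x - t⌋ : ℝ) < x - t :=
        lt_of_le_of_ne (Int.floor_le _) fun h => ht ⌊x - t⌋ (by linarith)
      have h2 := Int.lt_floor_add_one (x - t)
      have hev : ∀ᶠ y in 𝓝 x, d x t = d y t := by
        filter_upwards [Ioo_mem_nhds (a := ⌊x - t⌋ + t) (b := ⌊x - t⌋ + 1 + t) (by linarith)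
          (by linarith)] with y hy
        have : ⌊y - t⌋ = ⌊x - t⌋ := Int.floor_eq_iff.2 ⟨by linarith [hy.1], by linarith [hy.2]⟩
        simp only [d, this]
      exact continuousAt_const.congr hev
  · intro x y hxy
    constructor
    · intro heq hcon
      have hpos := hνpos x y hcon
      have h0 : 0 < ∫ t, (d y t - d x t) ∂ν := by
        rw [integral_pos_iff_support_of_nonneg (fun t => sub_nonneg.2 (hdmono x y hxy t))
          ((hdint y).sub (hdint x))]
        refine hpos.trans_le (measure_mono fun t ht => ?_)
        have h1 : ⌊x - t⌋ < 0 := Int.floor_lt.2 (by push_cast; linarith [ht.1])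
        have h2 : 0 ≤ ⌊y - t⌋ := Int.floor_nonneg.2 (by linarith [ht.2])
        have h3 : (⌊x - t⌋ : ℝ) < ⌊y - t⌋ := by exact_mod_cast h1.trans_le h2
        rw [Function.mem_support]
        simp only [d]
        linarith
      rw [integral_sub (hdint y) (hdint x), ← hH, ← hH, heq, sub_self] at h0
      exact lt_irrefl _ h0
    · intro hgap
      refine integral_congr_ae ?_
      have hCae : ∀ᵐ t ∂ν, t ∈ C := by
        rw [ae_iff]
        exact hν0
      filter_upwards [hCae, hnull y] with t ht hty
      have : ⌊x - t⌋ = ⌊y - t⌋ := by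
        refine le_antisymm (Int.floor_le_floor (by linarith)) (not_lt.1 fun hlt => hgap ?_)
        have h1 := Int.floor_lt.1 hlt
        have h2 := Int.floor_le (y - t)
        exact ⟨t + ⌊y - t⌋, hZ t ht _, by linarith, lt_of_le_of_ne (by linarith) (hty _)⟩
      simp only [d, this]

end NonatomicMeasure

/-! ### Minimal sets and the minimal factor -/

section MinimalSet

lemma exists_minimal_invariant (Γ : Subgroup CircleDeg1Liftˣ)
    (hZ : ∀ n : ℤ, translate (Multiplicative.ofAdd (n : ℝ)) ∈ Γ) :
    ∃ C : Set ℝ, IsClosed C ∧ C.Nonempty ∧ (∀ F ∈ Γ, ∀ x ∈ C, F x ∈ C) ∧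
      ∀ D ⊆ C, IsClosed D → D.Nonempty → (∀ F ∈ Γ, ∀ x ∈ D, F x ∈ D) → D = C := by
  let S : Set (Set ℝ) := {C | IsClosed C ∧ C.Nonempty ∧ ∀ F ∈ Γ, ∀ x ∈ C, F x ∈ C}
  obtain ⟨C, hC⟩ := zorn_superset S (by
    intro c hc hchain
    rcases c.eq_empty_or_nonempty with rfl | hcne
    · exact ⟨univ, ⟨isClosed_univ, univ_nonempty, fun _ _ _ _ => mem_univ _⟩, fun s hs => hs.elim⟩
    have : Nonempty c := hcne.to_subtype
    refine ⟨⋂₀ c, ⟨isClosed_sInter fun s hs => (hc hs).1, ?_, fun F hF x hx s hs =>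
      (hc hs).2.2 F hF x (hx s hs)⟩, fun s hs => sInter_subset_of_mem hs⟩
    -- Integer translations make every member of the chain meet `[0, 1]`, which supplies
    -- compactness.
    have hne := IsCompact.nonempty_iInter_of_directed_nonempty_isCompact_isClosed
      (fun s : c => (s : Set ℝ) ∩ Icc 0 1) ?_ ?_ ?_ ?_
    · obtain ⟨x, hx⟩ := hne
      exact ⟨x, fun s hs => (mem_iInter.1 hx ⟨s, hs⟩).1⟩
    · intro s t
      rcases hchain.total s.2 t.2 with h | h
      · exact ⟨s, subset_rfl, inter_subset_inter_left _ h⟩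
      · exact ⟨t, inter_subset_inter_left _ h, subset_rfl⟩
    · intro s
      obtain ⟨x, hx⟩ := (hc s.2).2.1
      have := (hc s.2).2.2 _ (hZ (-⌊x⌋)) x hx
      rw [translate_neg_floor_apply] at this
      exact ⟨_, this, Int.fract_nonneg _, (Int.fract_lt_one _).le⟩
    · exact fun s => isCompact_Icc.inter_left (hc s.2).1
    · exact fun s => (hc s.2).1.inter isClosed_Icc)
  exact ⟨C, hC.prop.1, hC.prop.2.1, hC.prop.2.2, fun D hDC h1 h2 h3 =>
    subset_antisymm hDC (hC.le_of_le ⟨h1, h2, h3⟩ hDC)⟩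

variable {G : Type*} [Group G]

/-- An action which is not of type `0` has a factor all of whose orbits are dense. -/
theorem exists_minimal_factor (φ : G →* HomeoPlus) (hφ : ¬ IsTypeZero φ) :
    ∃ (φ' : G →* HomeoPlus) (H : CircleDeg1Lift) (h : S1 → S1), IsLift H h ∧
      (∀ g x, φ' g (h x) = h (φ g x)) ∧ IsMinimalOnLine (liftGroup φ') ∧
      ∀ F ∈ liftGroup φ, ∃ F' ∈ liftGroup φ', ∀ x, F' (H x) = H (F x) := by
  have hT := translate_mem_liftGroup φ
  obtain ⟨C, hC, hCne, hCinv, hCmin⟩ := exists_minimal_invariant (liftGroup φ) hT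
  have hCZ : ∀ x ∈ C, ∀ n : ℤ, x + n ∈ C := by
    intro x hx n
    have := hCinv _ (hT n) x hx
    rwa [CircleDeg1Lift.translate_apply, add_comm] at this
  have horbit : ∀ x ∈ C, ∀ a b, (C ∩ Ioo a b).Nonempty → ∃ F ∈ liftGroup φ, F x ∈ Ioo a b := by
    rintro x hx a b ⟨p, hp, hpab⟩
    have hD := hCmin (closure ((fun F : CircleDeg1Liftˣ => F x) '' liftGroup φ))
      (closure_minimal (by rintro _ ⟨F, hF, rfl⟩; exact hCinv F hF x hx) hC) isClosed_closure
      (Set.Nonempty.closure ⟨_, 1, one_mem _, rfl⟩) (by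
        intro F hF y hy
        refine map_mem_closure (units_continuous F) hy ?_
        rintro _ ⟨E, hE, rfl⟩
        exact ⟨F * E, mul_mem hF hE, rfl⟩)
    rw [← hD] at hp
    obtain ⟨_, hy, F, hF, rfl⟩ := mem_closure_iff.1 hp _ isOpen_Ioo hpab
    exact ⟨F, hF, hy⟩
  -- The derived set of `C` is closed and invariant, so by minimality it is `C` once nonempty. If `C
  -- ∩ [0, 1]` were finite, `φ` would have a finite invariant set and be of type 0.
  have hperf : Preperfect C := by
    have hDsub : derivedSet C ⊆ C := isClosed_iff_derivedSet_subset C |>.1 hC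
    have hDne : (derivedSet C).Nonempty := by
      have hinf : (C ∩ Icc 0 1).Infinite := by
        intro hfin
        refine hφ (isTypeZero_of_finite_invariant φ (hfin.image ((↑) : ℝ → S1)) ?_ ?_)
        · obtain ⟨x, hx⟩ := hCne
          refine ⟨_, x + (-⌊x⌋ : ℤ), ⟨hCZ x hx _, ?_⟩, rfl⟩
          rw [Int.cast_neg, ← sub_eq_add_neg, Int.self_sub_floor]
          exact ⟨Int.fract_nonneg _, (Int.fract_lt_one _).le⟩
        · rintro g _ ⟨x, ⟨hx, -⟩, rfl⟩
          obtain ⟨F, hF⟩ := (φ g).2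
          have hFx := hCinv F ⟨g, hF⟩ x hx
          refine ⟨F x + (-⌊F x⌋ : ℤ), ⟨hCZ _ hFx _, ?_⟩, ?_⟩
          · rw [Int.cast_neg, ← sub_eq_add_neg, Int.self_sub_floor]
            exact ⟨Int.fract_nonneg _, (Int.fract_lt_one _).le⟩
          · have h0 : (((-⌊F x⌋ : ℤ) : ℝ) : S1) = 0 :=
              (AddCircle.coe_eq_zero_iff (1 : ℝ)).2 ⟨-⌊F x⌋, by simp⟩
            rw [AddCircle.coe_add, h0, add_zero]
            exact hF x
      obtain ⟨x, -, hx⟩ := hinf.exists_accPt_of_subset_isCompact isCompact_Icc inter_subset_right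
      exact ⟨x, hx.mono (principal_mono.2 inter_subset_left)⟩
    have hD := hCmin _ hDsub (isClosed_derivedSet C) hDne (by
      intro F hF x hx
      rw [mem_derivedSet, accPt_iff_nhds] at hx ⊢
      intro U hU
      obtain ⟨y, ⟨hyU, hyC⟩, hne⟩ := hx _ ((units_continuous F).continuousAt hU)
      exact ⟨F y, ⟨hyU, hCinv F hF y hyC⟩, (units_strictMono F).injective.ne hne⟩)
    intro x hx
    rw [← hD] at hx
    exact hx
  obtain ⟨H, hHcont, hH⟩ := exists_collapse hC hperf hCne hCZ
  have hHsurj := (continuous_iff_surjective H).1 hHcont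
  have hper : Function.Periodic (fun t => ((H t : ℝ) : S1)) (1 : ℝ) := by
    intro t
    simp only [map_add_one, AddCircle.coe_add, AddCircle.coe_period, add_zero]
  have hresp : ∀ F ∈ liftGroup φ, ∀ x y, x ≤ y → H x = H y → H (F x) = H (F y) := by
    intro F hF x y hxy h
    rw [hH _ _ ((F : CircleDeg1Lift).monotone hxy)]
    rintro ⟨p, hp, h1, h2⟩
    refine (hH x y hxy).1 h ⟨F⁻¹ p, hCinv _ (inv_mem hF) p hp, ?_, ?_⟩
    · rwa [← (units_strictMono F).lt_iff_lt, units_apply_inv_apply]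
    · rwa [← (units_strictMono F).lt_iff_lt, units_apply_inv_apply]
  have hresp' : ∀ F ∈ liftGroup φ, ∀ x y, H x = H y → H (F x) = H (F y) := by
    intro F hF x y h
    rcases le_total x y with hxy | hxy
    · exact hresp F hF x y hxy h
    · exact (hresp F hF y x hxy h.symm).symm
  obtain ⟨φ', hsemi, hfac, -⟩ := exists_factor φ H.monotone hHsurj (h := hper.lift)
    (fun _ => rfl) hresp' (by
      intro F hF x y h
      rw [← map_add_one, ← map_add_one]
      rw [← map_add_one] at h
      exact hresp' F hF _ _ h)
  refine ⟨φ', H, hper.lift, fun _ => rfl, hsemi, ?_, hfac⟩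
  intro y a b hab
  obtain ⟨w, rfl⟩ := hHsurj y
  -- Take the last point of `C` not beyond `w`; no point of `C` lies strictly between.
  obtain ⟨x, hxC, hxw⟩ : ∃ x ∈ C, H x = H w := by
    have hne : (C ∩ Iic w).Nonempty := by
      obtain ⟨p, hp⟩ := hCne
      refine ⟨p + (-⌈p - w⌉ : ℤ), hCZ p hp _, ?_⟩
      have := Int.le_ceil (p - w)
      rw [mem_Iic]
      push_cast
      linarith
    have hbdd : BddAbove (C ∩ Iic w) := ⟨w, fun z hz => hz.2⟩
    have hmem := (hC.inter isClosed_Iic).csSup_mem hne hbdd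
    refine ⟨_, hmem.1, (hH _ _ hmem.2).2 ?_⟩
    rintro ⟨p, hp, h1, h2⟩
    exact (le_csSup hbdd ⟨hp, h2.le⟩).not_gt h1
  -- `H` is only weakly monotone, so the target is shrunk to `[a', b']` inside `(a, b)` to keep
  -- strict inequalities.
  obtain ⟨a', haa', ha'b⟩ := exists_between hab
  obtain ⟨b', hab', hb'b⟩ := exists_between ha'b
  obtain ⟨u, rfl⟩ := hHsurj a'
  obtain ⟨v, rfl⟩ := hHsurj b'
  have huv : u < v := H.monotone.reflect_lt hab'
  have hmeet : (C ∩ Ioo u v).Nonempty := by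
    by_contra hcon
    exact hab'.ne ((hH u v huv.le).2 hcon)
  obtain ⟨F, hF, h1, h2⟩ := horbit x hxC u v hmeet
  obtain ⟨F', hF', hF'H⟩ := hfac F hF
  refine ⟨F', hF', ?_⟩
  rw [← hxw, hF'H]
  exact ⟨haa'.trans_le (H.monotone h1.le), (H.monotone h2.le).trans_lt hb'b⟩

end MinimalSet

/-! ### The type determines the norm -/

section ActionType

variable {G : Type*} [Group G]

lemma IsMinimalOnLine.not_hasGlobalFixedPoint {φ : G →* HomeoPlus}
    (h : IsMinimalOnLine (liftGroup φ)) : ¬ HasGlobalFixedPoint φ := by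
  rintro ⟨x, hx⟩
  induction x using QuotientAddGroup.induction_on with
  | H t =>
    obtain ⟨F, ⟨g, hF⟩, h1, h2⟩ := h t t (t + 1) (by linarith)
    have e : ((F t - t : ℝ) : S1) = 0 := by
      rw [AddCircle.coe_sub, hF]
      exact sub_eq_zero.2 (hx g)
    obtain ⟨n, hn⟩ := (AddCircle.coe_eq_zero_iff (1 : ℝ)).1 e
    simp only [zsmul_eq_mul, mul_one] at hn
    have h3 : (0 : ℝ) < n := by linarith
    have h4 : (n : ℝ) < 1 := by linarith
    have h5 : 0 < n := by exact_mod_cast h3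
    have h6 : n < 1 := by exact_mod_cast h4
    omega

lemma IsMinimalOnLine.isMinimalAction {φ : G →* HomeoPlus}
    (h : IsMinimalOnLine (liftGroup φ)) : IsMinimalAction φ := by
  rintro C hC ⟨p, hp⟩ hinv
  induction p using QuotientAddGroup.induction_on with
  | H t =>
    have hdense : Dense (((↑) : ℝ → S1) ⁻¹' C) := by
      refine dense_of_exists_between fun a b hab => ?_
      obtain ⟨F, ⟨g, hF⟩, h1, h2⟩ := h t a b hab
      refine ⟨F t, ?_, h1, h2⟩
      rw [mem_preimage, hF, ← hinv g]
      exact mem_image_of_mem _ hp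
    have huniv : closure (((↑) : ℝ → S1) ⁻¹' C) = ((↑) : ℝ → S1) ⁻¹' C :=
      (hC.preimage (AddCircle.continuous_mk' 1)).closure_eq
    rw [hdense.closure_eq] at huniv
    refine eq_univ_of_forall fun y => ?_
    induction y using QuotientAddGroup.induction_on with
    | H s =>
      have hs := mem_univ s
      rwa [huniv] at hs

lemma supNorm_le {b : G → G → ℝ} {r : ℝ} (h : ∀ g₁ g₂, |b g₁ g₂| ≤ r) : supNorm b ≤ r :=
  ciSup_le fun p => h p.1 p.2

lemma le_supNorm_pullbackEulerCocycle (φ : G →* HomeoPlus) (g₁ g₂ : G) :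
    |pullbackEulerCocycle φ g₁ g₂| ≤ supNorm (pullbackEulerCocycle φ) :=
  le_ciSup (bddAbove_pullbackEulerCocycle φ) (g₁, g₂)

lemma IsFoldLift.supNorm_le {m : ℕ} (hm : 1 ≤ m) {ψ χ : G →* HomeoPlus} (hψ : IsFoldLift m ψ χ) :
    supNorm (pullbackEulerCocycle ψ) ≤ 1 / (m : ℝ) := by
  refine CircleAction.supNorm_le fun g₁ g₂ => ?_
  have hm0 : (0 : ℝ) < m := by exact_mod_cast hm
  have h1 := abs_eulerCocycle_le_one (χ g₁) (χ g₂)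
  have h2 := hψ.mul_pullbackEulerCocycle g₁ g₂
  change |pullbackEulerCocycle χ g₁ g₂| ≤ 1 at h1
  rw [← h2, abs_mul, abs_of_pos hm0] at h1
  rw [le_div_iff₀ hm0]
  linarith

lemma IsMinimalModel.pullbackEulerCocycle_eq {φ φ' : G →* HomeoPlus} (hφ : ¬ IsTypeZero φ)
    (h : IsMinimalModel φ φ') : pullbackEulerCocycle φ = pullbackEulerCocycle φ' := by
  rcases h.2 with h | ⟨-, hfix, f, hf, hsemi⟩
  · exact (hφ (isTypeZero_of_hasGlobalFixedPoint φ h.1)).elim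
  · exact pullbackEulerCocycle_eq_of_semiconj hfix hf hsemi

/-- A minimal action on the line whose lifts have `Θ` of order `k` modulo the unit translation in
their centralizer is conjugate to a `k`-fold lift. -/
lemma exists_conj_isFoldLift {φ : G →* HomeoPlus} (hφ : IsMinimalOnLine (liftGroup φ))
    {Θ : CircleDeg1Liftˣ} {k : ℕ} (hk : 1 ≤ k)
    (hcomm : ∀ F ∈ liftGroup φ, ∀ x, Θ (F x) = F (Θ x))
    (hpow : Θ ^ k = translate (Multiplicative.ofAdd (1 : ℝ))) :
    ∃ (K : CircleDeg1Liftˣ) (f : HomeoPlus) (φ' χ : G →* HomeoPlus), IsLift (K : CircleDeg1Lift) f ∧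
      (∀ g x, φ' g (f x) = f (φ g x)) ∧ IsMinimalOnLine (liftGroup φ') ∧ IsFoldLift k φ' χ := by
  have hk0 : (0 : ℝ) < k := by exact_mod_cast hk
  -- Averaging the first `k` iterates of `Θ` conjugates it to the translation by `1/k`, because `Θ ^
  -- k x - x = 1`.
  obtain ⟨K, hK⟩ := exists_units_map_eq_add Θ k hk
  have hKΘ : ∀ x, K (Θ x) = K x + 1 / k := by
    intro x
    rw [hK, hpow, CircleDeg1Lift.translate_apply, add_sub_cancel_right]
  obtain ⟨f, hf⟩ := exists_homeoPlus_isLift K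
  obtain ⟨φ', hsemi, hfac, hfac'⟩ := exists_factor φ (K : CircleDeg1Lift).monotone
    (fun y => ⟨K⁻¹ y, units_apply_inv_apply K y⟩) (h := f) hf
    (fun F _ x y h => by rw [(units_strictMono K).injective h])
    (fun F _ x y h => by
      rw [← map_add_one] at h
      rw [(units_strictMono K).injective h, map_add_one, map_add_one])
  have hrot : ∀ F' ∈ liftGroup φ', ∀ y, F' (y + 1 / k) = F' y + 1 / k := by
    intro F' hF' y
    obtain ⟨F, hF, n, hn⟩ := hfac' F' hF'
    rw [← units_apply_inv_apply K y, ← hKΘ, hn, hn, ← hcomm F hF, hKΘ]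
    ring
  -- Commuting with the translation by `1/k` is what lets the lifts descend along `x ↦ k x`.
  obtain ⟨χ, hχ, -⟩ := exists_factor φ' (H := fun x => k * x) (h := fun x => k • x)
    (fun x y h => mul_le_mul_of_nonneg_left h hk0.le)
    (fun y => ⟨y / k, mul_div_cancel₀ y hk0.ne'⟩)
    (fun x => by rw [← nsmul_eq_mul]; rfl)
    (fun F _ x y h => by rw [mul_left_cancel₀ hk0.ne' h])
    (fun F hF x y h => by
      have hxy : x = y + 1 / k := by
        field_simp
        linarith
      rw [hxy, hrot F hF, mul_add, mul_one_div_cancel hk0.ne'])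
  refine ⟨K, f, φ', χ, hf, hsemi, fun y a b hab => ?_, hχ⟩
  obtain ⟨F, hF, h1, h2⟩ := hφ (K⁻¹ y) (K⁻¹ a) (K⁻¹ b) (units_strictMono K⁻¹ hab)
  obtain ⟨F', hF', hF'K⟩ := hfac F hF
  have e := hF'K (K⁻¹ y)
  rw [units_apply_inv_apply] at e
  refine ⟨F', hF', ?_⟩
  rw [e]
  constructor
  · simpa only [units_apply_inv_apply] using units_strictMono K h1
  · simpa only [units_apply_inv_apply] using units_strictMono K h2

theorem exists_minimalModel_isFoldLift (φ : G →* HomeoPlus) (hφ : ¬ IsTypeZero φ) :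
    ∃ k : ℕ, 1 ≤ k ∧ (∃ φ' : G →* HomeoPlus, IsMinimalModel φ φ' ∧ ∃ χ : G →* HomeoPlus,
      IsFoldLift k φ' χ) ∧ supNorm (pullbackEulerCocycle φ) = 1 / (k : ℝ) := by
  obtain ⟨φ₁, H, h, hH, hsemi, hmin, hfac⟩ := exists_minimal_factor φ hφ
  have hT := translate_mem_liftGroup φ₁
  have hcontr : ∃ x y, x < y ∧ Contractible (liftGroup φ₁) x y := by
    by_contra! hcon
    obtain ⟨R, hR⟩ := exists_equivariant_of_not_contractible hmin (by simpa using hT 1) hcon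
    -- Composing with the factor map transports equivariance back to `φ` itself, which would then be
    -- of type 0.
    refine hφ (isTypeZero_of_equivariant φ (R * H) fun F hF => ?_)
    obtain ⟨F', hF', hF'H⟩ := hfac F hF
    obtain ⟨c, hc⟩ := hR F' hF'
    exact ⟨c, fun x => by rw [mul_apply, mul_apply, ← hF'H, hc]⟩
  obtain ⟨x₀, y₀, h0, hcontr⟩ := hcontr
  obtain ⟨Θ, k, hk, hcomm, hlt, hpow, hΘ⟩ := exists_centralizing_of_contractible hmin hT h0 hcontr
  obtain ⟨K, f, φ₂, χ, hf, hsemi₂, hmin₂, hχ⟩ := exists_conj_isFoldLift hmin hk hcomm hpow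
  have hmodel : IsMinimalModel φ φ₂ := by
    refine ⟨hmin₂.isMinimalAction, Or.inr
      ⟨fun hfix => hφ (isTypeZero_of_hasGlobalFixedPoint φ hfix), hmin₂.not_hasGlobalFixedPoint,
        fun x => f (h x), ⟨K * H, fun x => ?_⟩, fun g x => ?_⟩⟩
    · rw [mul_apply, hf, hH]
    · rw [hsemi₂, hsemi]
  refine ⟨k, hk, ⟨φ₂, hmodel, χ, hχ⟩, le_antisymm ?_ ?_⟩
  · rw [hmodel.pullbackEulerCocycle_eq hφ]
    exact hχ.supNorm_le hk
  · obtain ⟨F, ⟨a, hF⟩, E, ⟨b, hE⟩, h1, h2, h3⟩ :=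
      exists_translationNumber_of_contractible hmin hT hk hcomm hlt hpow hΘ
    rw [pullbackEulerCocycle_eq_of_semiconj hmin.not_hasGlobalFixedPoint ⟨H, hH⟩ hsemi]
    refine le_trans ?_ ((le_abs_self _).trans (le_supNorm_pullbackEulerCocycle φ₁ a b))
    rw [pullbackEulerCocycle, eulerCocycle_eq hF hE]
    linarith

theorem exists_isOfType (φ : G →* HomeoPlus) (hφ : ¬ IsTypeZero φ) :
    ∃ k : ℕ, IsOfType k φ ∧ supNorm (pullbackEulerCocycle φ) = 1 / (k : ℝ) := by
  obtain ⟨k, hk, hmodel, hnorm⟩ := exists_minimalModel_isFoldLift φ hφ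
  refine ⟨k, ⟨hφ, ⟨hk, hmodel⟩, ?_⟩, hnorm⟩
  rintro m ⟨hm, φ', hφ', χ, hχ⟩
  have h1 := hχ.supNorm_le hm
  rw [← hφ'.pullbackEulerCocycle_eq hφ, hnorm] at h1
  have hm0 : (0 : ℝ) < m := by exact_mod_cast hm
  have hk0 : (0 : ℝ) < k := by exact_mod_cast hk
  rw [one_div_le_one_div hk0 hm0] at h1
  exact_mod_cast h1

end ActionType

end CircleAction

end

theorem mainTheorem5 {G : Type*} [Group G] (φ : G →* CircleAction.HomeoPlus)
    (k : ℕ) (hk : 1 ≤ k) :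
    CircleAction.IsOfType k φ ↔
      CircleAction.supNorm (CircleAction.pullbackEulerCocycle φ) = 1 / (k : ℝ) := by
  constructor
  · intro h
    obtain ⟨k', hk', hnorm⟩ := CircleAction.exists_isOfType φ h.1
    rw [hnorm, h.2.unique hk'.2]
  · intro h
    have hφ : ¬ CircleAction.IsTypeZero φ := by
      intro h0
      have hle : CircleAction.supNorm (CircleAction.pullbackEulerCocycle φ) ≤ 0 :=
        CircleAction.supNorm_le fun g₁ g₂ => by
          rw [h0.pullbackEulerCocycle_eq_zero, abs_zero]
      have hk0 : (0 : ℝ) < 1 / k := by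
        have : (0 : ℝ) < k := by exact_mod_cast hk
        positivity
      linarith
    obtain ⟨k', hk', hnorm⟩ := CircleAction.exists_isOfType φ hφ
    have hkk : k = k' := by
      rw [h, one_div, one_div, inv_inj] at hnorm
      exact_mod_cast hnorm
    rw [hkk]
    exact hk'
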